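/- Let $n\ge 1$, let $\theta=(\theta_1,\dots,\theta_n)^\top\in\mathbb R^n$ be such that $p(x)=x^n-\theta_1x^{n-1}-\dots-\theta_{n-1}x-\theta_n$ is a Schur polynomial (all its complex roots lie in the open unit disc), let $\sigma>0$, and let $\{e_t\}_{t\in\mathbb Z}$ be i.i.d. $\mathcal N(0,\sigma^2)$ random variables. Let $\{y_t\}_{t\in\mathbb Z}$ be a (strictly) stationary process with $$y_t=Y_{t-1}^\top\theta+e_t\quad\text{a.s. for every } t\in\mathbb Z,\qquad Y_t:=[\,y_t\;\;y_{t-1}\;\cdots\;y_{t-n+1}\,]^\top .$$ Put $$A:=\begin{bmatrix}\theta^\top&0\\ I_n&0_{n\times1}\end{bmatrix}\in\mathbb R^{(n+1)\times(n+1)},\qquad B:=\begin{bmatrix}1\\0_{n\times1}\end{bmatrix},\qquad \overline V:=\sigma^2\sum_{i=0}^\infty A^iBB^\top(A^\top)^i .$$ For an integer $N>n$ let $Y:=[\,Y_n\;\cdots\;Y_{N-1}\,]^\top\in\mathbb R^{(N-n)\times n}$, and for $\epsilon>0$ define $$V_{\rm dn}:=(N-n)\,[\,I_n\;\;0\,]\Big(\overline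 V-\epsilon\sigma^2\sum_{i=0}^\infty A^i(A^\top)^i\Big)\begin{bmatrix}I_n\\0\end{bmatrix},\qquad V_{\rm up}:=(N-n)\,[\,I_n\;\;0\,]\Big(\overline V+\epsilon\sigma^2\sum_{i=0}^\infty A^i(A^\top)^i\Big)\begin{bmatrix}I_n\\0\end{bmatrix},$$ $$M_\Phi:=\max_{\omega\in\mathbb R}\big|e^{j\omega n}-\theta_1e^{j\omega(n-1)}-\dots-\theta_n\big|^{-2},\qquad \tilde\beta:=\frac{(n+1)N}{N-n}\left[\frac{\mathbb E\{y_1^2\}}{\epsilon\sigma^2}+\frac{2M_\Phi(1+\epsilon^{-1/2})}{N^{1/4}}\right],$$ where $j$ is the imaginary unit, and $$\delta(\epsilon,N):=2\Big\{\sqrt2\exp\Big(\frac{-(N-n)\sigma^2\epsilon}{24\,n\,\mathbb E\{y_1^2\}}\Big)+\exp\Big[-\frac{N-n}{2}\Big(1+\frac\epsilon3-\sqrt{1+\frac{2\epsilon}{3}}\Big)\Big]+\exp\Big[-\frac{(N-n)\epsilon}{72(\|\theta\|_2+1)^2\tilde\beta}\Big]+\exp(-\epsilon\sqrt N)\Big\}.$$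 Then, for every $\epsilon>0$ such that $V_{\rm dn}\succ0$, $$\mathbb P\big(V_{\rm dn}\preceq Y^\top Y\preceq V_{\rm up}\big)\ge 1-\delta(\epsilon,N),$$ where $\preceq$ is the Loewner order on symmetric matrices. -/

import Mathlib

open MeasureTheory ProbabilityTheory Polynomial

noncomputable section

namespace ARProcess

/-- Strict stationarity of a real process indexed by `ℤ`: every time shift of the process has the
same law (on the product space `ℤ → ℝ`) as the process itself. -/
def IsStationary {Ω : Type*} [MeasurableSpace Ω] (P : Measure Ω) (y : ℤ → Ω → ℝ) : Prop :=
  ∀ h : ℤ, IdentDistrib (fun ω (t : ℤ) => y (t + h) ω) (fun ω (t : ℤ) => y t ω) P P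

/-- Gaussian white noise of variance `σ ^ 2`: i.i.d. centred Gaussian variables. -/
def IsGaussianWhiteNoise {Ω : Type*} [MeasurableSpace Ω] (P : Measure Ω) (σ : ℝ)
    (e : ℤ → Ω → ℝ) : Prop :=
  iIndepFun e P ∧ ∀ t : ℤ, HasLaw (e t) (gaussianReal 0 (Real.toNNReal (σ ^ 2))) P

/-- The regressor `Y_t = [y_t, y_{t-1}, …, y_{t-n+1}]` at a sample point. -/
def regressor {Ω : Type*} (n : ℕ) (y : ℤ → Ω → ℝ) (t : ℤ) (ω : Ω) : Fin n → ℝ :=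
  fun j => y (t - (j : ℕ)) ω

/-- The recursion `y_t = Y_{t-1}ᵀ θ + e_t` holds almost surely, for every time `t`.
The coefficient `θ_k` of the text is `θ (k - 1)` here. -/
def SatisfiesAR {Ω : Type*} [MeasurableSpace Ω] (P : Measure Ω) {n : ℕ}
    (θ : EuclideanSpace ℝ (Fin n)) (y e : ℤ → Ω → ℝ) : Prop :=
  ∀ t : ℤ, ∀ᵐ ω ∂P, y t ω = (∑ k : Fin n, regressor n y (t - 1) ω k * θ k) + e t ω

/-- `p(x) = x ^ n - θ_1 x ^ (n - 1) - ⋯ - θ_{n-1} x - θ_n`. -/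
def charPoly {n : ℕ} (θ : EuclideanSpace ℝ (Fin n)) : ℝ[X] :=
  X ^ n - ∑ k : Fin n, C (θ k) * X ^ (n - 1 - (k : ℕ))

/-- All complex roots lie in the open unit disc. -/
def IsSchur (p : ℝ[X]) : Prop :=
  ∀ z : ℂ, aeval z p = 0 → ‖z‖ < 1

/-- The transition matrix `[[θᵀ, 0], [I_n, 0]]` of the state-space form. -/
def transition {n : ℕ} (θ : EuclideanSpace ℝ (Fin n)) : Matrix (Fin (n + 1)) (Fin (n + 1)) ℝ :=
  Matrix.of (Fin.cons (Fin.snoc (fun k : Fin n => θ k) 0)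
    (fun i : Fin n => Pi.single i.castSucc 1))

/-- The input column `[1, 0, …, 0]ᵀ`. -/
def input (n : ℕ) : Matrix (Fin (n + 1)) (Fin 1) ℝ :=
  Matrix.of fun i _ => if i = 0 then 1 else 0

/-- The output matrix `[I_n 0]`. -/
def output (n : ℕ) : Matrix (Fin n) (Fin (n + 1)) ℝ :=
  Matrix.of fun i j => if j = i.castSucc then 1 else 0

/-- `V̄ = σ² ∑ A^i B Bᵀ (Aᵀ)^i`. -/
def Vbar {n : ℕ} (θ : EuclideanSpace ℝ (Fin n)) (σ : ℝ) : Matrix (Fin (n + 1)) (Fin (n + 1)) ℝ :=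
  σ ^ 2 • ∑' i : ℕ, transition θ ^ i * input n * (input n).transpose * (transition θ).transpose ^ i

/-- `∑ A^i (Aᵀ)^i`. -/
def gramian {n : ℕ} (θ : EuclideanSpace ℝ (Fin n)) : Matrix (Fin (n + 1)) (Fin (n + 1)) ℝ :=
  ∑' i : ℕ, transition θ ^ i * (transition θ).transpose ^ i

/-- The lower matrix. -/
def Vdn {n : ℕ} (θ : EuclideanSpace ℝ (Fin n)) (σ ε : ℝ) (N : ℕ) : Matrix (Fin n) (Fin n) ℝ :=
  ((N : ℝ) - n) • (output n * (Vbar θ σ - (ε * σ ^ 2) • gramian θ) * (output n).transpose)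

/-- The upper matrix. -/
def Vup {n : ℕ} (θ : EuclideanSpace ℝ (Fin n)) (σ ε : ℝ) (N : ℕ) : Matrix (Fin n) (Fin n) ℝ :=
  ((N : ℝ) - n) • (output n * (Vbar θ σ + (ε * σ ^ 2) • gramian θ) * (output n).transpose)

/-- `M_Φ = max_ω |e^{jωn} - θ_1 e^{jω(n-1)} - ⋯ - θ_n|⁻²`. -/
def MPhi {n : ℕ} (θ : EuclideanSpace ℝ (Fin n)) : ℝ :=
  ⨆ w : ℝ, (‖aeval (Complex.exp (w * Complex.I)) (charPoly θ)‖ ^ 2)⁻¹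

/-- The quantity `β̃`; `m` stands for `E{y_1²}`. -/
def betaTilde {n : ℕ} (θ : EuclideanSpace ℝ (Fin n)) (σ m ε : ℝ) (N : ℕ) : ℝ :=
  ((n : ℝ) + 1) * N / ((N : ℝ) - n) *
    (m / (ε * σ ^ 2) + 2 * MPhi θ * (1 + ε ^ (-(1 / 2) : ℝ)) / (N : ℝ) ^ (1 / 4 : ℝ))

/-- The failure probability `δ(ε, N)`; `m` stands for `E{y_1²}`. -/
def delta {n : ℕ} (θ : EuclideanSpace ℝ (Fin n)) (σ m ε : ℝ) (N : ℕ) : ℝ :=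
  2 * (Real.sqrt 2 * Real.exp (-(((N : ℝ) - n) * σ ^ 2 * ε) / (24 * n * m))
    + Real.exp (-(((N : ℝ) - n) / 2) * (1 + ε / 3 - Real.sqrt (1 + 2 * ε / 3)))
    + Real.exp (-((((N : ℝ) - n) * ε) / (72 * (‖θ‖ + 1) ^ 2 * betaTilde θ σ m ε N)))
    + Real.exp (-(ε * Real.sqrt N)))

/-- The data matrix `Y = [Y_n … Y_{N-1}]ᵀ` at a sample point; its row `i` is `Y_{n+i}ᵀ`. -/
def dataMatrix {Ω : Type*} (n N : ℕ) (y : ℤ → Ω → ℝ) (ω : Ω) : Matrix (Fin (N - n)) (Fin n) ℝ :=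
  Matrix.of fun i => regressor n y ((n : ℤ) + (i : ℕ)) ω

end ARProcess

end

noncomputable section

namespace ARProcess

/-! ### Exponential moments of squares of Gaussian variables -/

section GaussianMoments

open Real

/-! Write `x k` for the state `[y_t, …, y_{t-n}]` at consecutive times, so that `x (k+1) = A x k + u
k B`, and let `S` be the sum of `x k (x k)ᵀ` over `K = N - n` steps. Telescoping shows that `S - A S
Aᵀ` equals `(∑ u k ^ 2) B Bᵀ` plus two boundary terms `x 0 (x 0)ᵀ - x K (x K)ᵀ` and a cross term `v
Bᵀ + B vᵀ`, where `v = ∑ u k A x k`. If the boundary terms, the cross term and the fluctuation of `∑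
u k ^ 2` each cost at most a third of `K ε σ²`, then `S` solves the Stein equation of `K V̄` up to
`± K ε σ² I`. As `A` is stable, the Stein equation preserves the Loewner order
(`posSemidef_of_stein`), and compression by `[I 0]` gives the two bounds. This part is deterministic
(`isWithinBounds_of_state_bounds`).

The probability lies in four tail bounds. The boundary states are Gaussian vectors, handled by
Jensen's inequality (`measure_sum_sq_ge_le`). The noise energy is chi-square
(`measure_noise_sq_ge_le`). The cross term is a vector-valued Gaussian martingale transform, for
which `cosh` of the norm, corrected by the bracket, is a supermartingale (`measure_norm_sum_ge_le`).
Its bracket is controlled by the output energy, a Gaussian quadratic form whose operator norm is at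
most `σ² MPhi` by Parseval on the unit circle (`sum_sq_state_le`, `measure_energy_ge_le`).

All this is carried out for the process started at rest, an explicit linear function of the noise,
because nothing in the hypotheses directly makes `y` a causal function of `e`. The stationary
process is an almost sure limit of such processes started ever earlier, and since the good event is
closed, the bound passes to the limit. -/

lemma gaussianPDFReal_mul_exp_sq {v : NNReal} (hv : v ≠ 0) (s x : ℝ) :
    gaussianPDFReal 0 v x * exp (s * x ^ 2)
      = (√(2 * π * v))⁻¹ * exp (-(1 / (2 * v) - s) * x ^ 2) := by
  rw [gaussianPDFReal_def, mul_assoc, ← exp_add]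
  have : (v : ℝ) ≠ 0 := by exact_mod_cast hv
  congr 2
  field_simp
  ring

lemma inv_two_var_sub_pos {v : NNReal} (hv : v ≠ 0) {s : ℝ} (hs : 2 * s * v < 1) :
    0 < 1 / (2 * (v : ℝ)) - s := by
  have : (0 : ℝ) < v := by positivity
  rw [sub_pos, lt_div_iff₀ (by positivity)]
  linarith

lemma integrable_exp_sq_gaussianReal {v : NNReal} {s : ℝ} (hs : 2 * s * v < 1) :
    Integrable (fun x => exp (s * x ^ 2)) (gaussianReal 0 v) := by
  rcases eq_or_ne v 0 with rfl | hv
  · rw [gaussianReal_zero_var]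
    exact integrable_dirac (by simp)
  · rw [gaussianReal_of_var_ne_zero _ hv, integrable_withDensity_iff_integrable_smul₀'
      (measurable_gaussianPDF 0 v).aemeasurable (ae_of_all _ fun _ => gaussianPDF_lt_top)]
    simp only [toReal_gaussianPDF, smul_eq_mul, gaussianPDFReal_mul_exp_sq hv]
    exact (integrable_exp_neg_mul_sq (inv_two_var_sub_pos hv hs)).const_mul _

lemma integral_exp_sq_gaussianReal {v : NNReal} {s : ℝ} (hs : 2 * s * v < 1) :
    ∫ x, exp (s * x ^ 2) ∂(gaussianReal 0 v) = (√(1 - 2 * s * v))⁻¹ := by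
  rcases eq_or_ne v 0 with rfl | hv
  · simp [gaussianReal_zero_var]
  · have hv0 : (0 : ℝ) < v := by positivity
    have h1 := inv_two_var_sub_pos hv hs
    simp only [integral_gaussianReal_eq_integral_smul hv, smul_eq_mul,
      gaussianPDFReal_mul_exp_sq hv, integral_const_mul, integral_gaussian]
    rw [← sqrt_inv, ← sqrt_inv, ← sqrt_mul (by positivity)]
    congr 1
    have : 1 - 2 * s * v ≠ 0 := by linarith
    have h2 : 1 / (2 * (v : ℝ)) - s = (1 - 2 * s * v) / (2 * v) := by field_simp
    rw [h2]
    field_simp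

/-- This follows from `log r ≤ sinh (log r) = (r - r⁻¹) / 2` at `r = (1 - 2u)⁻¹`. Together with
`inv_sqrt_one_add_le`, it turns the chi-square moment generating function into the sub-gamma form
needed for Laurent–Massart tails. -/
lemma inv_sqrt_one_sub_le {u : ℝ} (h0 : 0 ≤ u) (h1 : 2 * u < 1) :
    (√(1 - 2 * u))⁻¹ ≤ exp (u + u ^ 2 / (1 - 2 * u)) := by
  have hp : 0 < 1 - 2 * u := by linarith
  rw [← sqrt_inv]
  apply sqrt_le_iff.2 ⟨(exp_pos _).le, ?_⟩
  rw [← exp_nat_mul, ← log_le_iff_le_exp (by positivity)]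
  have key : log (1 - 2 * u)⁻¹ ≤ 2 * u + 2 * u ^ 2 / (1 - 2 * u) := by
    have hr : 1 ≤ (1 - 2 * u)⁻¹ := (one_le_inv₀ hp).2 (by linarith)
    refine (self_le_sinh_iff.2 (log_nonneg hr)).trans (le_of_eq ?_)
    rw [sinh_log (by positivity), inv_inv]
    field_simp
    ring
  refine key.trans (le_of_eq ?_)
  push_cast
  ring

lemma inv_sqrt_one_add_le {u : ℝ} (h0 : 0 ≤ u) :
    (√(1 + 2 * u))⁻¹ ≤ exp (-u + u ^ 2) := by
  rw [← sqrt_inv]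
  apply sqrt_le_iff.2 ⟨(exp_pos _).le, ?_⟩
  rw [← exp_nat_mul, ← log_le_iff_le_exp (by positivity), log_inv]
  have h1 := le_log_one_add_of_nonneg (x := 2 * u) (by linarith)
  have h2 : 2 * u - 2 * u ^ 2 ≤ 2 * (2 * u) / (2 * u + 2) := by
    rw [le_div_iff₀ (by linarith)]
    nlinarith [mul_nonneg h0 (sq_nonneg u)]
  push_cast
  linarith

/-- Both `p + d` and `p - d` are convex combinations of `p + D` and `p - D`, with the weights
exchanged. -/
lemma convexOn_add_le_add_of_abs_le {f : ℝ → ℝ} (hf : ConvexOn ℝ (Set.Ici 0) f) {p d D : ℝ}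
    (hd : |d| ≤ D) (hD : D ≤ p) : f (p + d) + f (p - d) ≤ f (p + D) + f (p - D) := by
  rcases (abs_nonneg d).trans hd |>.eq_or_lt with h0 | h0
  · have : d = 0 := abs_nonpos_iff.1 (h0 ▸ hd)
    simp [this, ← h0]
  obtain ⟨hd1, hd2⟩ := abs_le.1 hd
  have ha : 0 ≤ (D + d) / (2 * D) := div_nonneg (by linarith) (by linarith)
  have hb : 0 ≤ (D - d) / (2 * D) := div_nonneg (by linarith) (by linarith)
  have hab : (D + d) / (2 * D) + (D - d) / (2 * D) = 1 := by field_simp; ring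
  have hx : p + D ∈ Set.Ici (0 : ℝ) := by simp; linarith
  have hy : p - D ∈ Set.Ici (0 : ℝ) := by simp; linarith
  have e1 := hf.2 hx hy ha hb hab
  have e2 := hf.2 hx hy hb ha (by rw [add_comm]; exact hab)
  simp only [smul_eq_mul] at e1 e2
  rw [show (D + d) / (2 * D) * (p + D) + (D - d) / (2 * D) * (p - D) = p + d by
    field_simp; ring] at e1
  rw [show (D - d) / (2 * D) * (p + D) + (D + d) / (2 * D) * (p - D) = p - d by
    field_simp; ring] at e2
  calc _ ≤ ((D + d) / (2 * D) + (D - d) / (2 * D)) * (f (p + D) + f (p - D)) := by linarith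
    _ = _ := by rw [hab, one_mul]

/-- Collinear vectors are the worst case. The series of `cosh` involves only powers of `‖x ± w‖ ^ 2
= p ± d` with `d = 2⟪x, w⟫`, and each power is convex, so every term grows when `|d|` is raised to
`2‖x‖‖w‖`. This replaces the scalar addition formula and keeps the martingale bound dimension-free.
-/
lemma cosh_add_cosh_le_of_norm {E : Type*} [NormedAddCommGroup E] [InnerProductSpace ℝ E]
    (x w : E) : cosh ‖x + w‖ + cosh ‖x - w‖ ≤ 2 * (cosh ‖x‖ * cosh ‖w‖) := by
  have h : 2 * (cosh ‖x‖ * cosh ‖w‖) = cosh (‖x‖ + ‖w‖) + cosh (‖x‖ - ‖w‖) := by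
    rw [cosh_add, cosh_sub]; ring
  rw [h]
  refine hasSum_le (fun k => ?_) ((hasSum_cosh _).add (hasSum_cosh _))
    ((hasSum_cosh _).add (hasSum_cosh _))
  rw [← add_div, ← add_div]
  refine div_le_div_of_nonneg_right ?_ (by positivity)
  simp only [pow_mul]
  have hd : |2 * inner ℝ x w| ≤ 2 * (‖x‖ * ‖w‖) := by
    rw [abs_mul, abs_two]
    exact mul_le_mul_of_nonneg_left (abs_real_inner_le_norm x w) two_pos.le
  have hD : 2 * (‖x‖ * ‖w‖) ≤ ‖x‖ ^ 2 + ‖w‖ ^ 2 := by nlinarith [sq_nonneg (‖x‖ - ‖w‖)]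
  have := convexOn_add_le_add_of_abs_le (convexOn_pow k) hd hD
  rw [norm_add_sq_real, norm_sub_sq_real]
  ring_nf at this ⊢
  exact this

lemma lintegral_cosh_gaussianReal (v : NNReal) (b : ℝ) :
    ∫⁻ a, ENNReal.ofReal (cosh (a * b)) ∂(gaussianReal 0 v)
      = ENNReal.ofReal (exp (b ^ 2 * v / 2)) := by
  have h1 := integrable_exp_mul_gaussianReal (μ := 0) (v := v) b
  have h2 := integrable_exp_mul_gaussianReal (μ := 0) (v := v) (-b)
  have m1 : ∫ a, exp (b * a) ∂(gaussianReal 0 v) = exp (v * b ^ 2 / 2) := by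
    simpa [mgf] using congrFun (mgf_id_gaussianReal (μ := 0) (v := v)) b
  have m2 : ∫ a, exp (-b * a) ∂(gaussianReal 0 v) = exp (v * b ^ 2 / 2) := by
    simpa [mgf] using congrFun (mgf_id_gaussianReal (μ := 0) (v := v)) (-b)
  have e : (fun a => cosh (a * b)) = fun a => (exp (b * a) + exp (-b * a)) / 2 := by
    ext a
    rw [cosh_eq, neg_mul, mul_comm b a]
  rw [← ofReal_integral_eq_lintegral_ofReal]
  · rw [e, integral_div, integral_add h1 h2, m1, m2]
    congr 1
    ring_nf
  · rw [e]
    exact (h1.add h2).div_const 2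
  · exact ae_of_all _ fun a => (cosh_pos _).le

/-- The symmetry of the Gaussian law allows averaging over `a` and `-a`, after which
`cosh_add_cosh_le_of_norm` reduces to the scalar integral. -/
lemma lintegral_cosh_norm_gaussianReal_le {E : Type*} [NormedAddCommGroup E]
    [InnerProductSpace ℝ E] (v : NNReal) (x w : E) :
    ∫⁻ a, ENNReal.ofReal (cosh ‖x + a • w‖) ∂(gaussianReal 0 v)
      ≤ ENNReal.ofReal (cosh ‖x‖ * exp (‖w‖ ^ 2 * v / 2)) := by
  set μ := gaussianReal 0 v
  have hm (c : ℝ) : Measurable fun a : ℝ => ENNReal.ofReal (cosh ‖x + (c * a) • w‖) := by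
    refine (Continuous.measurable ?_).ennreal_ofReal
    exact continuous_cosh.comp (by fun_prop)
  have hneg : ∫⁻ a, ENNReal.ofReal (cosh ‖x + (-1 * a) • w‖) ∂μ
      = ∫⁻ a, ENNReal.ofReal (cosh ‖x + (1 * a) • w‖) ∂μ := by
    have hμ : μ.map (fun a => -a) = μ := by simp [μ, gaussianReal_map_neg]
    conv_rhs => rw [← hμ]
    rw [lintegral_map (hm 1) measurable_neg]
    simp
  have key : ∫⁻ a, ENNReal.ofReal (cosh ‖x + (1 * a) • w‖) ∂μ
        + ∫⁻ a, ENNReal.ofReal (cosh ‖x + (-1 * a) • w‖) ∂μ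
      ≤ 2 * ENNReal.ofReal (cosh ‖x‖ * exp (‖w‖ ^ 2 * v / 2)) := by
    rw [← lintegral_add_left (hm 1)]
    calc _ ≤ ∫⁻ a, ENNReal.ofReal (2 * cosh ‖x‖) * ENNReal.ofReal (cosh (a * ‖w‖)) ∂μ := by
          refine lintegral_mono fun a => ?_
          rw [← ENNReal.ofReal_add (cosh_pos _).le (cosh_pos _).le,
            ← ENNReal.ofReal_mul (by positivity)]
          refine ENNReal.ofReal_le_ofReal ?_
          have := cosh_add_cosh_le_of_norm x (a • w)
          rw [norm_smul, norm_eq_abs, ← cosh_abs (|a| * ‖w‖), abs_mul, abs_abs, ← abs_mul,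
            cosh_abs, ← mul_assoc] at this
          simpa [sub_eq_add_neg] using this
      _ = _ := by
          rw [lintegral_const_mul' _ _ ENNReal.ofReal_ne_top, lintegral_cosh_gaussianReal,
            ← ENNReal.ofReal_mul (by positivity), mul_assoc, ENNReal.ofReal_mul two_pos.le]
          simp
  rw [hneg, ← two_mul] at key
  simpa using (ENNReal.mul_le_mul_iff_right two_ne_zero ENNReal.ofNat_ne_top).1 key

end GaussianMoments

/-! ### Tail bounds for Gaussian quadratic forms -/

section QuadraticForms

open Real

variable {ι : Type*} [Fintype ι]

lemma integrable_exp_sum_sq_pi {a : ι → ℝ} (ha : ∀ i, 2 * a i < 1) :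
    Integrable (fun g : ι → ℝ => exp (∑ i, a i * g i ^ 2))
      (Measure.pi fun _ : ι => gaussianReal 0 1) := by
  simp only [exp_sum]
  exact Integrable.fintype_prod (f := fun i x => exp (a i * x ^ 2))
    fun i => integrable_exp_sq_gaussianReal (by simpa using ha i)

lemma integral_exp_sum_sq_pi {a : ι → ℝ} (ha : ∀ i, 2 * a i < 1) :
    ∫ g : ι → ℝ, exp (∑ i, a i * g i ^ 2) ∂(Measure.pi fun _ : ι => gaussianReal 0 1)
      = ∏ i, (√(1 - 2 * a i))⁻¹ := by
  simp only [exp_sum]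
  rw [integral_fintype_prod_eq_prod (f := fun i x => exp (a i * x ^ 2))]
  refine Finset.prod_congr rfl fun i _ => ?_
  simpa using integral_exp_sq_gaussianReal (v := 1) (s := a i) (by simpa using ha i)

/-- Upper tail of a weighted sum of squares of independent standard Gaussian variables. -/
lemma pi_gaussian_upper_tail {μ : ι → ℝ} {M τ K x : ℝ} (hM : 0 < M) (hK : 0 < K) (hx : 0 ≤ x)
    (h0 : ∀ i, 0 ≤ μ i) (h1 : ∀ i, μ i ≤ M) (hτ : ∑ i, μ i ≤ τ) (hKM : ∑ i, μ i ≤ K * M) :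
    (Measure.pi fun _ : ι => gaussianReal 0 1).real
        {g | τ + 2 * M * √(K * x) + 2 * M * x ≤ ∑ i, μ i * g i ^ 2} ≤ exp (-x) := by
  set k := √K with hk
  set r := √x with hr
  have hk0 : 0 < k := sqrt_pos.2 hK
  have hr0 : 0 ≤ r := sqrt_nonneg _
  have hkK : k ^ 2 = K := sq_sqrt hK.le
  have hrx : r ^ 2 = x := sq_sqrt hx
  -- The minimiser of the Chernoff exponent, at which it equals exactly `-x`.
  set s := r / (M * (k + 2 * r)) with hs
  have hs0 : 0 ≤ s := by positivity
  have hsM : 1 - 2 * (s * M) = k / (k + 2 * r) := by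
    rw [hs]; field_simp; ring
  have hsM' : 0 < 1 - 2 * (s * M) := by rw [hsM]; positivity
  have ha (i) : 2 * (s * μ i) < 1 := by
    have := mul_le_mul_of_nonneg_left (h1 i) hs0
    linarith
  have hsum (g : ι → ℝ) : s * ∑ i, μ i * g i ^ 2 = ∑ i, (s * μ i) * g i ^ 2 := by
    rw [Finset.mul_sum]; exact Finset.sum_congr rfl fun i _ => by ring
  have hint := integrable_exp_sum_sq_pi ha
  have hch := measure_ge_le_exp_mul_mgf (X := fun g : ι → ℝ => ∑ i, μ i * g i ^ 2)
    (μ := Measure.pi fun _ : ι => gaussianReal 0 1) (τ + 2 * M * √(K * x) + 2 * M * x) hs0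
    (by simpa only [hsum] using hint)
  refine hch.trans ?_
  rw [mgf]
  simp only [hsum]
  rw [integral_exp_sum_sq_pi ha]
  have hprod : ∏ i, (√(1 - 2 * (s * μ i)))⁻¹
      ≤ exp (s * τ + s ^ 2 * M * (K * M) / (1 - 2 * (s * M))) := by
    calc ∏ i, (√(1 - 2 * (s * μ i)))⁻¹
        ≤ ∏ i, exp (s * μ i + s ^ 2 * M * μ i / (1 - 2 * (s * M))) := by
          refine Finset.prod_le_prod (fun i _ => by positivity) fun i _ => ?_
          refine (inv_sqrt_one_sub_le (mul_nonneg hs0 (h0 i)) (ha i)).trans ?_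
          refine exp_le_exp.2 (add_le_add_right ?_ _)
          refine div_le_div₀ (by have := h0 i; positivity) ?_ hsM' ?_
          · rw [mul_pow, sq (μ i), mul_assoc]
            exact mul_le_mul_of_nonneg_left
              (mul_le_mul_of_nonneg_right (h1 i) (h0 i)) (sq_nonneg s)
          · have := mul_le_mul_of_nonneg_left (h1 i) hs0
            linarith
      _ = exp (s * ∑ i, μ i + s ^ 2 * M * (∑ i, μ i) / (1 - 2 * (s * M))) := by
          rw [← exp_sum, Finset.sum_add_distrib, Finset.mul_sum, Finset.mul_sum, Finset.sum_div]
      _ ≤ _ := by gcongr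
  refine (mul_le_mul_of_nonneg_left hprod (exp_pos _).le).trans ?_
  rw [← exp_add]
  refine exp_le_exp.2 (le_of_eq ?_)
  rw [hsM, sqrt_mul hK.le, ← hk, ← hr, ← hkK, ← hrx, hs]
  field_simp
  ring

/-- Lower tail of the chi-square distribution. -/
lemma pi_gaussian_lower_tail [Nonempty ι] {x : ℝ} (hx : 0 ≤ x) :
    (Measure.pi fun _ : ι => gaussianReal 0 1).real
        {g | ∑ i, g i ^ 2 ≤ Fintype.card ι - 2 * √(Fintype.card ι * x)} ≤ exp (-x) := by
  have hK : (0 : ℝ) < Fintype.card ι := by exact_mod_cast Fintype.card_pos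
  set K : ℝ := (Fintype.card ι : ℝ)
  set k := √K with hk
  set r := √x with hr
  have hk0 : 0 < k := sqrt_pos.2 hK
  have hr0 : 0 ≤ r := sqrt_nonneg _
  have hkK : k ^ 2 = K := sq_sqrt hK.le
  have hrx : r ^ 2 = x := sq_sqrt hx
  set s := r / k with hs
  have hs0 : 0 ≤ s := by positivity
  have ha : ∀ _ : ι, 2 * (-s) < 1 := fun _ => by linarith
  have hsum (g : ι → ℝ) : -s * ∑ i, g i ^ 2 = ∑ i, (-s) * g i ^ 2 := Finset.mul_sum ..
  have hch := measure_le_le_exp_mul_mgf (X := fun g : ι → ℝ => ∑ i, g i ^ 2)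
    (μ := Measure.pi fun _ : ι => gaussianReal 0 1) (K - 2 * √(K * x)) (neg_nonpos.2 hs0)
    (by simpa only [hsum] using integrable_exp_sum_sq_pi ha)
  refine hch.trans ?_
  rw [mgf]
  simp only [hsum]
  rw [integral_exp_sum_sq_pi ha, Finset.prod_const, Finset.card_univ]
  have hp : (√(1 - 2 * -s))⁻¹ ^ Fintype.card ι ≤ exp (K * (-s + s ^ 2)) := by
    rw [exp_nat_mul]
    refine pow_le_pow_left₀ (by positivity) ?_ _
    simpa using inv_sqrt_one_add_le hs0
  refine (mul_le_mul_of_nonneg_left hp (exp_pos _).le).trans ?_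
  rw [← exp_add]
  refine exp_le_exp.2 (le_of_eq ?_)
  rw [sqrt_mul hK.le, ← hk, ← hr, ← hkK, ← hrx, hs]
  field_simp
  ring

/-- Upper tail of `‖C g‖ ^ 2` for a standard Gaussian vector `g`. -/
lemma stdGaussian_norm_sq_upper_tail {E F : Type*} [NormedAddCommGroup E] [InnerProductSpace ℝ E]
    [FiniteDimensional ℝ E] [MeasurableSpace E] [BorelSpace E]
    [NormedAddCommGroup F] [InnerProductSpace ℝ F] [FiniteDimensional ℝ F]
    (C : E →ₗ[ℝ] F) (b : OrthonormalBasis ι ℝ E) {M τ K x : ℝ} (hM : 0 < M) (hK : 0 < K)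
    (hx : 0 ≤ x) (h1 : ∀ u, ‖C u‖ ^ 2 ≤ M * ‖u‖ ^ 2) (hτ : ∑ i, ‖C (b i)‖ ^ 2 ≤ τ)
    (hKM : ∑ i, ‖C (b i)‖ ^ 2 ≤ K * M) :
    (stdGaussian E).real {u | τ + 2 * M * √(K * x) + 2 * M * x ≤ ‖C u‖ ^ 2} ≤ exp (-x) := by
  -- In an eigenbasis of `C* C` the form is diagonal, and the standard Gaussian has independent
  -- coordinates in every orthonormal basis. The trace is basis-independent, so the hypotheses on
  -- `b` carry over to the eigenvalues.
  set T : E →ₗ[ℝ] E := LinearMap.adjoint C ∘ₗ C with hT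
  have hTs : T.IsSymmetric := fun u v => by
    simp [hT, LinearMap.adjoint_inner_left, LinearMap.adjoint_inner_right]
  have hTi (u : E) : inner ℝ u (T u) = ‖C u‖ ^ 2 := by
    simp [hT, LinearMap.adjoint_inner_right]
  set v := hTs.eigenvectorBasis rfl
  set μ := hTs.eigenvalues rfl
  have hμ (i) : μ i = ‖C (v i)‖ ^ 2 := by
    rw [← hTi, hTs.apply_eigenvectorBasis rfl i]
    simp [real_inner_smul_right, v, μ]
  have htr : ∑ i, μ i = ∑ i, ‖C (b i)‖ ^ 2 := by
    simp only [hμ, ← hTi]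
    rw [← LinearMap.trace_eq_sum_inner, ← LinearMap.trace_eq_sum_inner]
  have hquad (g : Fin (Module.finrank ℝ E) → ℝ) :
      ‖C (∑ i, g i • v i)‖ ^ 2 = ∑ i, μ i * g i ^ 2 := by
    rw [← hTi, map_sum]
    simp only [map_smul, sum_inner, inner_sum]
    refine Finset.sum_congr rfl fun i _ => ?_
    rw [Finset.sum_eq_single i]
    · rw [hTs.apply_eigenvectorBasis rfl i]
      simp [real_inner_smul_right, real_inner_smul_left, v, μ]
      ring
    · intro j _ hji
      rw [hTs.apply_eigenvectorBasis rfl i]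
      simp only [real_inner_smul_right, real_inner_smul_left]
      rw [hTs.eigenvectorBasis rfl |>.inner_eq_zero hji]
      simp
    · simp
  have hC : Continuous C := C.continuous_of_finiteDimensional
  have hmeas : MeasurableSet {u | τ + 2 * M * √(K * x) + 2 * M * x ≤ ‖C u‖ ^ 2} :=
    (isClosed_le continuous_const (by fun_prop)).measurableSet
  have hmf : Measurable fun g : Fin (Module.finrank ℝ E) → ℝ => ∑ i, g i • v i := by fun_prop
  rw [stdGaussian_eq_map_pi_orthonormalBasis v, map_measureReal_apply hmf hmeas]
  simp only [Set.preimage_ofPred_eq, hquad]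
  refine pi_gaussian_upper_tail hM hK hx (fun i => ?_) (fun i => ?_) (htr ▸ hτ) (htr ▸ hKM)
  · rw [hμ]; positivity
  · rw [hμ]
    simpa using h1 (v i)

end QuadraticForms

/-! ### The transition matrix -/

section Transition

open Matrix Filter Topology

variable {n : ℕ} (θ : EuclideanSpace ℝ (Fin n))

lemma transition_zero_castSucc (k : Fin n) : transition θ 0 k.castSucc = θ k := by
  simp [transition]

lemma transition_zero_last : transition θ 0 (Fin.last n) = 0 := by
  simp [transition]

lemma transition_succ (i : Fin n) : transition θ i.succ = Pi.single i.castSucc 1 := by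
  ext j
  simp [transition]

lemma transition_mulVec_zero (x : Fin (n + 1) → ℝ) :
    (transition θ *ᵥ x) 0 = ∑ k : Fin n, θ k * x k.castSucc := by
  simp [mulVec, dotProduct, Fin.sum_univ_castSucc, transition_zero_castSucc, transition_zero_last]

lemma transition_mulVec_succ (x : Fin (n + 1) → ℝ) (i : Fin n) :
    (transition θ *ᵥ x) i.succ = x i.castSucc := by
  simp [mulVec, transition_succ]

lemma map_transition_mulVec_zero (x : Fin (n + 1) → ℂ) :
    ((transition θ).map (algebraMap ℝ ℂ) *ᵥ x) 0 = ∑ k : Fin n, (θ k : ℂ) * x k.castSucc := by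
  simp [mulVec, dotProduct, Fin.sum_univ_castSucc, transition_zero_castSucc, transition_zero_last]

lemma map_transition_mulVec_succ (x : Fin (n + 1) → ℂ) (i : Fin n) :
    ((transition θ).map (algebraMap ℝ ℂ) *ᵥ x) i.succ = x i.castSucc := by
  simp [mulVec, dotProduct, transition_succ, Pi.single_apply, apply_ite, ite_mul]

lemma aeval_charPoly (z : ℂ) :
    aeval z (charPoly θ) = z ^ n - ∑ k : Fin n, (θ k : ℂ) * z ^ (n - 1 - (k : ℕ)) := by
  simp [charPoly]

variable {θ}

/-- The shift rows force an eigenvector to be proportional to `(z ^ n, …, z, 1)`, and the first row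
then reads `z * p(z) = 0`. The extra dimension only adds the eigenvalue `0`. -/
lemma norm_lt_one_of_mem_spectrum (h : IsSchur (charPoly θ)) {z : ℂ}
    (hz : z ∈ spectrum ℂ ((transition θ).map (algebraMap ℝ ℂ))) : ‖z‖ < 1 := by
  rcases eq_or_ne z 0 with rfl | hz0
  · simp
  rw [← Matrix.spectrum_toLin', ← Module.End.hasEigenvalue_iff_mem_spectrum] at hz
  obtain ⟨v, hv⟩ := hz.exists_hasEigenvector
  have hv1 : (transition θ).map (algebraMap ℝ ℂ) *ᵥ v = z • v := by
    simpa using hv.apply_eq_smul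
  have hstep (i : Fin n) : v i.castSucc = z * v i.succ := by
    rw [← map_transition_mulVec_succ θ v i, hv1]; rfl
  have hpow : ∀ i : Fin (n + 1), v i = z ^ (n - (i : ℕ)) * v (Fin.last n) := by
    intro i
    induction i using Fin.reverseInduction with
    | last => simp
    | cast i ih =>
      rw [hstep, ih, ← mul_assoc, ← pow_succ']
      congr 2
      simp
      omega
  have ha : v (Fin.last n) ≠ 0 := fun h0 => hv.2 (by ext i; rw [hpow i, h0]; simp)
  have h0 : ∑ k : Fin n, (θ k : ℂ) * v k.castSucc = z * v 0 := by
    rw [← map_transition_mulVec_zero θ v, hv1]; rfl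
  apply h
  rw [aeval_charPoly, sub_eq_zero]
  have h1 : z * (z ^ n * v (Fin.last n))
      = z * ((∑ k : Fin n, (θ k : ℂ) * z ^ (n - 1 - (k : ℕ))) * v (Fin.last n)) := by
    have := hpow 0
    simp only [Fin.val_zero, Nat.sub_zero] at this
    rw [← this, ← h0, Finset.sum_mul, Finset.mul_sum]
    refine Finset.sum_congr rfl fun k _ => ?_
    rw [hpow, Fin.val_castSucc, show n - (k : ℕ) = n - 1 - k + 1 by omega, pow_succ]
    ring
  exact mul_right_cancel₀ ha (mul_left_cancel₀ hz0 h1)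

section Decay

attribute [local instance] Matrix.linftyOpNormedRing Matrix.linftyOpNormedAlgebra

lemma norm_apply_le_linfty {m : Type*} [Fintype m] [DecidableEq m] (B : Matrix m m ℂ) (i j : m) :
    ‖B i j‖ ≤ ‖B‖ := by
  rw [← coe_nnnorm, ← coe_nnnorm, NNReal.coe_le_coe, Matrix.linfty_opNNNorm_def]
  refine le_trans ?_ (Finset.le_sup (f := fun i => ∑ j, ‖B i j‖₊) (Finset.mem_univ i))
  exact Finset.single_le_sum (f := fun j => ‖B i j‖₊) (fun _ _ => zero_le) (Finset.mem_univ j)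

/-- The powers of the transition matrix of a Schur polynomial decay geometrically. -/
lemma exists_transition_pow_le (h : IsSchur (charPoly θ)) :
    ∃ C r : ℝ, 0 < C ∧ 0 < r ∧ r < 1 ∧ ∀ k i j, |(transition θ ^ k) i j| ≤ C * r ^ k := by
  set a : Matrix (Fin (n + 1)) (Fin (n + 1)) ℂ := (transition θ).map (algebraMap ℝ ℂ) with ha
  have : CompleteSpace (Matrix (Fin (n + 1)) (Fin (n + 1)) ℂ) :=
    FiniteDimensional.complete ℂ _
  have hρ : spectralRadius ℂ a < (1 : NNReal) :=
    spectrum.spectralRadius_lt_of_forall_lt a fun z hz => norm_lt_one_of_mem_spectrum h hz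
  obtain ⟨r, hr0, hr1⟩ := ENNReal.lt_iff_exists_nnreal_btwn.1 hρ
  have hr1' : (r : ℝ) < 1 := by exact_mod_cast hr1
  have hrpos : 0 < (r : ℝ) := by
    have : (0 : ENNReal) < r := (zero_le).trans_lt hr0
    exact_mod_cast this
  -- Gelfand's formula, with `r` strictly between the spectral radius and `1`.
  have hev : ∀ᶠ k : ℕ in atTop, ‖a ^ k‖ ≤ (r : ℝ) ^ k := by
    filter_upwards [(spectrum.pow_nnnorm_pow_one_div_tendsto_nhds_spectralRadius a).eventually
      (gt_mem_nhds hr0), eventually_gt_atTop 0] with k hk hk0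
    have hk0' : (0 : ℝ) < k := by exact_mod_cast hk0
    have := ENNReal.rpow_le_rpow hk.le hk0'.le
    rw [← ENNReal.rpow_mul, one_div, inv_mul_cancel₀ hk0'.ne', ENNReal.rpow_one,
      ENNReal.rpow_natCast] at this
    exact_mod_cast this
  have hO : (fun k : ℕ => a ^ k) =O[atTop] fun k : ℕ => (r : ℝ) ^ k := by
    refine Asymptotics.IsBigO.of_bound 1 ?_
    filter_upwards [hev] with k hk
    rw [one_mul, Real.norm_of_nonneg (by positivity)]
    exact hk
  obtain ⟨C, hC, hb⟩ := Asymptotics.bound_of_isBigO_nat_atTop hO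
  refine ⟨C, r, hC, hrpos, hr1', fun k i j => ?_⟩
  have h1 := hb (x := k) (by positivity)
  rw [Real.norm_of_nonneg (by positivity)] at h1
  refine le_trans (le_of_eq ?_) ((norm_apply_le_linfty (a ^ k) i j).trans h1)
  rw [ha, ← Matrix.map_pow, Matrix.map_apply]
  simp

end Decay

lemma tendsto_transition_pow (h : IsSchur (charPoly θ)) :
    Tendsto (fun k => transition θ ^ k) atTop (𝓝 0) := by
  obtain ⟨C, r, hC, hr0, hr1, hb⟩ := exists_transition_pow_le h
  refine tendsto_pi_nhds.2 fun i => tendsto_pi_nhds.2 fun j => ?_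
  refine squeeze_zero_norm (fun k => hb k i j) ?_
  simpa using (tendsto_pow_atTop_nhds_zero_of_lt_one hr0.le hr1).const_mul C

lemma summable_transition_conj (h : IsSchur (charPoly θ))
    (Q : Matrix (Fin (n + 1)) (Fin (n + 1)) ℝ) :
    Summable fun k => transition θ ^ k * Q * (transition θ)ᵀ ^ k := by
  obtain ⟨C, r, hC, hr0, hr1, hb⟩ := exists_transition_pow_le h
  refine Pi.summable.2 fun i => Pi.summable.2 fun j => ?_
  refine Summable.of_norm_bounded
    (g := fun k => (∑ b, ∑ a, C * |Q a b| * C) * r ^ k)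
    ((summable_geometric_of_lt_one hr0.le hr1).mul_left _) fun k => ?_
  rw [Matrix.mul_apply, Finset.sum_mul]
  refine (norm_sum_le _ _).trans (Finset.sum_le_sum fun b _ => ?_)
  rw [Matrix.mul_apply, Finset.sum_mul, Finset.sum_mul]
  refine (norm_sum_le _ _).trans (Finset.sum_le_sum fun a _ => ?_)
  rw [← transpose_pow, transpose_apply, norm_mul, norm_mul]
  have h1 : |(transition θ ^ k) j b| ≤ C :=
    (hb k j b).trans (mul_le_of_le_one_right hC.le (pow_le_one₀ hr0.le hr1.le))
  calc _ ≤ C * r ^ k * |Q a b| * C := by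
        gcongr
        exacts [hb k i a, le_rfl, h1]
    _ = _ := by ring

lemma isClosed_posSemidef {m : Type*} [Fintype m] :
    IsClosed {M : Matrix m m ℝ | M.PosSemidef} := by
  have : {M : Matrix m m ℝ | M.PosSemidef}
      = {M | Mᴴ = M} ∩ ⋂ x : m → ℝ, {M | 0 ≤ star x ⬝ᵥ (M *ᵥ x)} := by
    ext M
    simp [posSemidef_iff_dotProduct_mulVec, Matrix.IsHermitian]
  rw [this]
  refine (isClosed_eq (by fun_prop) continuous_id).inter (isClosed_iInter fun x => ?_)
  exact isClosed_le continuous_const (by fun_prop)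

/-- Solutions of the Stein equation with positive semidefinite right-hand side. -/
lemma posSemidef_of_stein (h : IsSchur (charPoly θ))
    {D Q : Matrix (Fin (n + 1)) (Fin (n + 1)) ℝ} (hQ : Q.PosSemidef)
    (hD : D = transition θ * D * (transition θ)ᵀ + Q) : D.PosSemidef := by
  set A := transition θ
  -- Iterating the equation `k` times leaves a remainder `A ^ k D (Aᵀ) ^ k` that tends to `0`, so
  -- `D` is a limit of positive semidefinite partial sums.
  have hpart (k : ℕ) :
      D = ∑ i ∈ Finset.range k, A ^ i * Q * Aᵀ ^ i + A ^ k * D * Aᵀ ^ k := by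
    induction k with
    | zero => simp
    | succ k ih =>
      rw [Finset.sum_range_succ, add_assoc]
      conv_lhs => rw [ih]
      congr 1
      conv_lhs => rw [hD]
      rw [mul_add, add_mul, add_comm (A ^ k * (A * D * Aᵀ) * Aᵀ ^ k), pow_succ A, pow_succ' Aᵀ]
      simp only [mul_assoc]
  have hlim : Tendsto (fun k => D - A ^ k * D * Aᵀ ^ k) atTop (𝓝 D) := by
    have h1 := tendsto_transition_pow h
    have h2 : Tendsto (fun k => Aᵀ ^ k) atTop (𝓝 0) := by
      have := (continuous_id.matrix_transpose.tendsto
        (0 : Matrix (Fin (n + 1)) (Fin (n + 1)) ℝ)).comp h1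
      simpa only [Function.comp_def, id, transpose_pow, transpose_zero] using this
    simpa using tendsto_const_nhds.sub ((h1.mul_const D).mul h2)
  refine isClosed_posSemidef.mem_of_tendsto hlim (Eventually.of_forall fun k => ?_)
  have : D - A ^ k * D * Aᵀ ^ k = ∑ i ∈ Finset.range k, A ^ i * Q * Aᵀ ^ i := by
    conv_lhs => enter [1]; rw [hpart k]
    simp
  rw [Set.mem_ofPred_eq, this]
  refine posSemidef_sum _ fun i _ => ?_
  rw [← transpose_pow, ← conjTranspose_eq_transpose_of_trivial]
  exact hQ.mul_mul_conjTranspose_same _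

lemma tsum_transition_conj (h : IsSchur (charPoly θ))
    (Q : Matrix (Fin (n + 1)) (Fin (n + 1)) ℝ) :
    ∑' k, transition θ ^ k * Q * (transition θ)ᵀ ^ k
      = transition θ * (∑' k, transition θ ^ k * Q * (transition θ)ᵀ ^ k) * (transition θ)ᵀ
        + Q := by
  have hs := summable_transition_conj h Q
  conv_lhs => rw [hs.tsum_eq_zero_add]
  rw [← hs.tsum_mul_left, ← (hs.mul_left _).tsum_mul_right]
  simp only [pow_zero, one_mul, mul_one]
  rw [add_comm Q]
  congr 1
  refine tsum_congr fun k => ?_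
  rw [pow_succ' (transition θ), pow_succ (transition θ)ᵀ]
  simp only [mul_assoc]

lemma Vbar_stein (h : IsSchur (charPoly θ)) (σ : ℝ) :
    Vbar θ σ = transition θ * Vbar θ σ * (transition θ)ᵀ + σ ^ 2 • (input n * (input n)ᵀ) := by
  have := tsum_transition_conj h (input n * (input n)ᵀ)
  simp only [← Matrix.mul_assoc] at this
  rw [Vbar]
  conv_lhs => rw [this]
  simp [smul_add]

lemma gramian_stein (h : IsSchur (charPoly θ)) :
    gramian θ = transition θ * gramian θ * (transition θ)ᵀ + 1 := by
  have := tsum_transition_conj h (1 : Matrix (Fin (n + 1)) (Fin (n + 1)) ℝ)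
  simp only [mul_one] at this
  exact this

end Transition

/-! ### Deterministic Loewner bounds -/

section Loewner

open Matrix

variable {n : ℕ} {θ : EuclideanSpace ℝ (Fin n)}

/-- The Gram matrix of the first `K` vectors of a sequence. -/
def stateGram (x : ℕ → Fin (n + 1) → ℝ) (K : ℕ) : Matrix (Fin (n + 1)) (Fin (n + 1)) ℝ :=
  ∑ k ∈ Finset.range K, vecMulVec (x k) (x k)

lemma isHermitian_stateGram (x : ℕ → Fin (n + 1) → ℝ) (K : ℕ) : (stateGram x K).IsHermitian := by
  rw [IsHermitian, conjTranspose_eq_transpose_of_trivial, stateGram, transpose_sum]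
  simp [transpose_vecMulVec]

lemma dotProduct_stateGram (x : ℕ → Fin (n + 1) → ℝ) (K : ℕ) (z : Fin (n + 1) → ℝ) :
    z ⬝ᵥ (stateGram x K *ᵥ z) = ∑ k ∈ Finset.range K, (x k ⬝ᵥ z) ^ 2 := by
  rw [stateGram, sum_mulVec, dotProduct_sum]
  refine Finset.sum_congr rfl fun k _ => ?_
  rw [vecMulVec_mulVec, dotProduct_smul, dotProduct_comm z]
  simp [sq]

lemma mul_stateGram_mul_transpose (A : Matrix (Fin (n + 1)) (Fin (n + 1)) ℝ)
    (x : ℕ → Fin (n + 1) → ℝ) (K : ℕ) :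
    A * stateGram x K * Aᵀ = stateGram (fun k => A *ᵥ x k) K := by
  simp only [stateGram, Matrix.mul_sum, Matrix.sum_mul, mul_vecMulVec, vecMulVec_mul,
    vecMul_transpose]

lemma sq_dotProduct_le (a z : Fin n → ℝ) : (a ⬝ᵥ z) ^ 2 ≤ (a ⬝ᵥ a) * (z ⬝ᵥ z) := by
  simpa [dotProduct, sq] using Finset.sum_mul_sq_le_sq_mul_sq Finset.univ a z

/-- The telescoping identity `htel` for the quadratic form at `z`, with each error bounded by
Cauchy–Schwarz. The budget `3 * c` is one `c` for the boundary, one for the cross term `2 (v ⬝ᵥ z) z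
0`, one for the noise energy. -/
lemma stateGram_sub_conj_bounds {A : Matrix (Fin (n + 1)) (Fin (n + 1)) ℝ}
    {x : ℕ → Fin (n + 1) → ℝ} {u : ℕ → ℝ} {K : ℕ} {c q : ℝ}
    (hx : ∀ k, x (k + 1) = A *ᵥ x k + u k • Pi.single 0 1)
    (h0 : x 0 ⬝ᵥ x 0 ≤ c) (hK : x K ⬝ᵥ x K ≤ c)
    (hu : |∑ k ∈ Finset.range K, u k ^ 2 - q| ≤ c)
    (hv : 4 * ((∑ k ∈ Finset.range K, u k • A *ᵥ x k) ⬝ᵥ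
      (∑ k ∈ Finset.range K, u k • A *ᵥ x k)) ≤ c ^ 2) (z : Fin (n + 1) → ℝ) :
    |z ⬝ᵥ (stateGram x K *ᵥ z) - z ⬝ᵥ ((A * stateGram x K * Aᵀ) *ᵥ z) - q * z 0 ^ 2|
      ≤ 3 * c * (z ⬝ᵥ z) := by
  set v := ∑ k ∈ Finset.range K, u k • A *ᵥ x k with hvdef
  rw [mul_stateGram_mul_transpose, dotProduct_stateGram, dotProduct_stateGram]
  have hzz : 0 ≤ z ⬝ᵥ z := by simpa using dotProduct_star_self_nonneg z
  have hc : 0 ≤ c := (abs_nonneg _).trans hu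
  have hz0 : z 0 ^ 2 ≤ z ⬝ᵥ z := by
    rw [dotProduct, sq]
    exact Finset.single_le_sum (f := fun i => z i * z i) (fun i _ => mul_self_nonneg _)
      (Finset.mem_univ 0)
  have hvz : v ⬝ᵥ z = ∑ k ∈ Finset.range K, u k * ((A *ᵥ x k) ⬝ᵥ z) := by
    simp [hvdef, sum_dotProduct]
  have htel : ∑ k ∈ Finset.range K, (x k ⬝ᵥ z) ^ 2 - ∑ k ∈ Finset.range K, ((A *ᵥ x k) ⬝ᵥ z) ^ 2
      = (x 0 ⬝ᵥ z) ^ 2 - (x K ⬝ᵥ z) ^ 2 + 2 * (v ⬝ᵥ z) * z 0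
        + (∑ k ∈ Finset.range K, u k ^ 2) * z 0 ^ 2 := by
    have h1 : ∀ k, (x (k + 1) ⬝ᵥ z) ^ 2 = ((A *ᵥ x k) ⬝ᵥ z) ^ 2
        + 2 * (u k * ((A *ᵥ x k) ⬝ᵥ z)) * z 0 + u k ^ 2 * z 0 ^ 2 := by
      intro k
      rw [hx, add_dotProduct, smul_dotProduct, single_dotProduct]
      simp
      ring
    have h2 := Finset.sum_range_succ' (fun k => (x k ⬝ᵥ z) ^ 2) K
    rw [Finset.sum_range_succ] at h2
    simp only [h1, Finset.sum_add_distrib] at h2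
    rw [hvz, Finset.mul_sum, Finset.sum_mul, Finset.sum_mul]
    linarith
  rw [htel]
  have b0 : (x 0 ⬝ᵥ z) ^ 2 ≤ c * (z ⬝ᵥ z) :=
    (sq_dotProduct_le _ _).trans (mul_le_mul_of_nonneg_right h0 hzz)
  have bK : (x K ⬝ᵥ z) ^ 2 ≤ c * (z ⬝ᵥ z) :=
    (sq_dotProduct_le _ _).trans (mul_le_mul_of_nonneg_right hK hzz)
  have bv : |2 * (v ⬝ᵥ z) * z 0| ≤ c * (z ⬝ᵥ z) := by
    refine abs_le_of_sq_le_sq ?_ (by positivity)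
    calc (2 * (v ⬝ᵥ z) * z 0) ^ 2 = 4 * (v ⬝ᵥ z) ^ 2 * z 0 ^ 2 := by ring
      _ ≤ 4 * ((v ⬝ᵥ v) * (z ⬝ᵥ z)) * (z ⬝ᵥ z) := by
          refine mul_le_mul (mul_le_mul_of_nonneg_left (sq_dotProduct_le _ _) (by norm_num)) hz0
            (sq_nonneg _) ?_
          have hvv : 0 ≤ v ⬝ᵥ v := by simpa using dotProduct_star_self_nonneg v
          positivity
      _ = 4 * (v ⬝ᵥ v) * (z ⬝ᵥ z) ^ 2 := by ring
      _ ≤ c ^ 2 * (z ⬝ᵥ z) ^ 2 := by gcongr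
      _ = _ := by ring
  have bu : |(∑ k ∈ Finset.range K, u k ^ 2 - q) * z 0 ^ 2| ≤ c * (z ⬝ᵥ z) := by
    rw [abs_mul, abs_of_nonneg (sq_nonneg (z 0))]
    gcongr
  -- The boundary squares enter with opposite signs, so their difference costs a single `c * (z ⬝ᵥ
  -- z)`.
  have e0 := sq_nonneg (x 0 ⬝ᵥ z)
  have eK := sq_nonneg (x K ⬝ᵥ z)
  rw [abs_le] at *
  constructor <;> nlinarith [bv.1, bv.2, bu.1, bu.2]

lemma dotProduct_input_mulVec (z : Fin (n + 1) → ℝ) :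
    z ⬝ᵥ ((input n * (input n)ᵀ) *ᵥ z) = z 0 ^ 2 := by
  have : input n * (input n)ᵀ = vecMulVec (Pi.single 0 1) (Pi.single 0 1) := by
    ext i j
    simp [input, Matrix.mul_apply, vecMulVec_apply, Pi.single_apply]
  rw [this, vecMulVec_mulVec, dotProduct_smul]
  simp [sq]

/-- Loewner bounds for the Gram matrix of an approximate solution of the Stein equation. -/
lemma loewner_bounds_of_stein (h : IsSchur (charPoly θ)) {S : Matrix (Fin (n + 1)) (Fin (n + 1)) ℝ}
    (hS : S.IsHermitian) {σ ε κ : ℝ}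
    (hb : ∀ z : Fin (n + 1) → ℝ,
      |z ⬝ᵥ (S *ᵥ z) - z ⬝ᵥ ((transition θ * S * (transition θ)ᵀ) *ᵥ z) - κ * σ ^ 2 * z 0 ^ 2|
        ≤ κ * (ε * σ ^ 2) * (z ⬝ᵥ z)) :
    (κ • (Vbar θ σ + (ε * σ ^ 2) • gramian θ) - S).PosSemidef ∧
      (S - κ • (Vbar θ σ - (ε * σ ^ 2) • gramian θ)).PosSemidef := by
  set A := transition θ with hA
  have hV := Vbar_stein h σ
  have hG := gramian_stein h
  rw [← hA] at hV hG
  have hS' : Sᵀ = S := by rw [← conjTranspose_eq_transpose_of_trivial]; exact hS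
  have hR : (S - A * S * Aᵀ)ᵀ = S - A * S * Aᵀ := by
    simp [transpose_mul, hS', Matrix.mul_assoc]
  have hB : (input n * (input n)ᵀ)ᵀ = input n * (input n)ᵀ := by simp [transpose_mul]
  -- Each `Q` is the Stein residual of the corresponding difference, read off from `Vbar_stein` and
  -- `gramian_stein`; `hb` says precisely that both are nonnegative.
  refine ⟨posSemidef_of_stein h (Q := κ • (σ ^ 2 • (input n * (input n)ᵀ) + (ε * σ ^ 2) • 1)
      - (S - A * S * Aᵀ)) ?_ ?_,
    posSemidef_of_stein h (Q := (S - A * S * Aᵀ)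
      - κ • (σ ^ 2 • (input n * (input n)ᵀ) - (ε * σ ^ 2) • 1)) ?_ ?_⟩
  · refine PosSemidef.of_dotProduct_mulVec_nonneg ?_ fun z => ?_
    · rw [IsHermitian, conjTranspose_eq_transpose_of_trivial, transpose_sub, hR, transpose_smul,
        transpose_add, transpose_smul, hB, transpose_smul, transpose_one]
    · have := (abs_le.1 (hb z)).2
      simp only [star_trivial, sub_mulVec, smul_mulVec, add_mulVec, dotProduct_sub, dotProduct_smul,
        dotProduct_add, dotProduct_input_mulVec, one_mulVec, smul_eq_mul]
      linarith
  · conv_lhs => rw [hV, hG]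
    simp only [mul_add, add_mul, mul_sub, sub_mul, smul_add, Matrix.mul_smul, Matrix.smul_mul]
    abel
  · refine PosSemidef.of_dotProduct_mulVec_nonneg ?_ fun z => ?_
    · rw [IsHermitian, conjTranspose_eq_transpose_of_trivial, transpose_sub, hR, transpose_smul,
        transpose_sub, transpose_smul, hB, transpose_smul, transpose_one]
    · have := (abs_le.1 (hb z)).1
      simp only [star_trivial, sub_mulVec, smul_mulVec, dotProduct_sub, dotProduct_smul,
        dotProduct_input_mulVec, one_mulVec, smul_eq_mul]
      linarith
  · conv_lhs => rw [hV, hG]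
    simp only [mul_sub, sub_mul, smul_add, smul_sub, Matrix.mul_smul,
      Matrix.smul_mul]
    abel

/-- The `N - n` rows formed by the first `n` coordinates of consecutive states. -/
def stateMatrix (n N : ℕ) (x : ℕ → Fin (n + 1) → ℝ) : Matrix (Fin (N - n)) (Fin n) ℝ :=
  Matrix.of fun i j => x i j.castSucc

lemma output_mul_mul_transpose (S : Matrix (Fin (n + 1)) (Fin (n + 1)) ℝ) :
    output n * S * (output n)ᵀ = S.submatrix Fin.castSucc Fin.castSucc := by
  ext i j
  simp [output, Matrix.mul_apply]

lemma stateMatrix_transpose_mul (N : ℕ) (x : ℕ → Fin (n + 1) → ℝ) :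
    (stateMatrix n N x)ᵀ * stateMatrix n N x
      = output n * stateGram x (N - n) * (output n)ᵀ := by
  rw [output_mul_mul_transpose]
  ext i j
  simp only [Matrix.mul_apply, transpose_apply, stateMatrix, Matrix.of_apply, submatrix_apply,
    stateGram, Matrix.sum_apply, vecMulVec_apply]
  exact Fin.sum_univ_eq_sum_range (fun k => x k i.castSucc * x k j.castSucc) (N - n)

/-- The event of the theorem, for a data matrix. -/
def IsWithinBounds (θ : EuclideanSpace ℝ (Fin n)) (σ ε : ℝ) (N : ℕ)
    (D : Matrix (Fin (N - n)) (Fin n) ℝ) : Prop :=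
  (Dᵀ * D - Vdn θ σ ε N).PosSemidef ∧ (Vup θ σ ε N - Dᵀ * D).PosSemidef

/-- Closedness is what lets the probability bound survive the passage to the stationary limit. -/
lemma isClosed_isWithinBounds (θ : EuclideanSpace ℝ (Fin n)) (σ ε : ℝ) (N : ℕ) :
    IsClosed {D | IsWithinBounds θ σ ε N D} := by
  refine IsClosed.inter (isClosed_posSemidef.preimage ?_) (isClosed_posSemidef.preimage ?_)
  · fun_prop
  · fun_prop

lemma isWithinBounds_of_state_bounds (h : IsSchur (charPoly θ)) {N : ℕ}
    {x : ℕ → Fin (n + 1) → ℝ} {u : ℕ → ℝ} {σ ε c : ℝ} (hc : 3 * c = ((N : ℝ) - n) * (ε * σ ^ 2))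
    (hx : ∀ k, x (k + 1) = transition θ *ᵥ x k + u k • Pi.single 0 1)
    (h0 : x 0 ⬝ᵥ x 0 ≤ c) (hK : x (N - n) ⬝ᵥ x (N - n) ≤ c)
    (hu : |∑ k ∈ Finset.range (N - n), u k ^ 2 - ((N : ℝ) - n) * σ ^ 2| ≤ c)
    (hv : 4 * ((∑ k ∈ Finset.range (N - n), u k • transition θ *ᵥ x k) ⬝ᵥ
      (∑ k ∈ Finset.range (N - n), u k • transition θ *ᵥ x k)) ≤ c ^ 2) :
    IsWithinBounds θ σ ε N (stateMatrix n N x) := by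
  have hb := stateGram_sub_conj_bounds hx h0 hK hu hv
  rw [hc] at hb
  obtain ⟨h1, h2⟩ := loewner_bounds_of_stein h (isHermitian_stateGram x (N - n)) hb
  have e1 := h1.mul_mul_conjTranspose_same (output n)
  have e2 := h2.mul_mul_conjTranspose_same (output n)
  rw [conjTranspose_eq_transpose_of_trivial, Matrix.mul_sub, Matrix.sub_mul] at e1 e2
  rw [IsWithinBounds, stateMatrix_transpose_mul, Vdn, Vup]
  exact ⟨by simpa only [Matrix.mul_smul, Matrix.smul_mul] using e2,
    by simpa only [Matrix.mul_smul, Matrix.smul_mul] using e1⟩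

end Loewner

/-! ### The process started at rest -/

section State

open Matrix Filter Topology

variable {n : ℕ} (θ : EuclideanSpace ℝ (Fin n))

/-- The state of the system driven by the noise `u`, started at rest. -/
def state (u : ℕ → ℝ) : ℕ → Fin (n + 1) → ℝ
  | 0 => 0
  | s + 1 => transition θ *ᵥ state u s + u s • Pi.single 0 1

/-- The impulse response. -/
def impulse (k : ℕ) : ℝ := (transition θ ^ k) 0 0

@[simp] lemma state_zero (u : ℕ → ℝ) : state θ u 0 = 0 := rfl

lemma state_succ (u : ℕ → ℝ) (s : ℕ) :
    state θ u (s + 1) = transition θ *ᵥ state θ u s + u s • Pi.single 0 1 := rfl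

lemma state_congr {u v : ℕ → ℝ} {s : ℕ} (h : ∀ r < s, u r = v r) : state θ u s = state θ v s := by
  induction s with
  | zero => rfl
  | succ s ih => rw [state_succ, state_succ, ih fun r hr => h r (by omega), h s (by omega)]

lemma state_eq_sum (u : ℕ → ℝ) (s : ℕ) :
    state θ u s = ∑ r ∈ Finset.range s, u r • (transition θ ^ (s - 1 - r) *ᵥ Pi.single 0 1) := by
  induction s with
  | zero => simp
  | succ s ih =>
    rw [state_succ, ih, mulVec_sum, Finset.sum_range_succ]
    simp only [Nat.add_sub_cancel, Nat.sub_self, pow_zero, one_mulVec, add_left_inj]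
    refine Finset.sum_congr rfl fun r hr => ?_
    have : s - r = s - 1 - r + 1 := by have := Finset.mem_range.1 hr; omega
    rw [mulVec_smul, mulVec_mulVec, ← pow_succ', this]

lemma state_apply_zero (u : ℕ → ℝ) (s : ℕ) :
    state θ u s 0 = ∑ r ∈ Finset.range s, impulse θ (s - 1 - r) * u r := by
  rw [state_eq_sum, Finset.sum_apply]
  refine Finset.sum_congr rfl fun r _ => ?_
  simp [impulse, mul_comm]

lemma state_succ_succ (u : ℕ → ℝ) (s : ℕ) (i : Fin n) :
    state θ u (s + 1) i.succ = state θ u s i.castSucc := by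
  simp [state_succ, transition_mulVec_succ]

/-- Coordinates of the state are delayed outputs. For `s < i` the truncated subtraction gives time
`0`, where the output vanishes, as befits a start at rest. -/
lemma state_apply (u : ℕ → ℝ) (s : ℕ) (i : Fin (n + 1)) :
    state θ u s i = state θ u (s - i) 0 := by
  induction s generalizing i with
  | zero => simp
  | succ s ih =>
    refine Fin.cases (by simp) (fun i => ?_) i
    rw [state_succ_succ, ih]
    simp

lemma state_succ_zero (u : ℕ → ℝ) (s : ℕ) :
    state θ u (s + 1) 0 = ∑ k : Fin n, θ k * state θ u (s - k) 0 + u s := by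
  rw [state_succ, Pi.add_apply, transition_mulVec_zero]
  simp [state_apply θ u s (Fin.castSucc _)]

lemma state_add (u : ℕ → ℝ) {s : ℕ} (k : ℕ) (hu : ∀ r, s ≤ r → u r = 0) :
    state θ u (s + k) = transition θ ^ k *ᵥ state θ u s := by
  induction k with
  | zero => simp
  | succ k ih =>
    rw [← add_assoc, state_succ, ih, hu _ (by omega), pow_succ', mulVec_mulVec]
    simp

variable {θ}

lemma tendsto_state_of_eventually_zero (h : IsSchur (charPoly θ)) {u : ℕ → ℝ} {s : ℕ}
    (hu : ∀ r, s ≤ r → u r = 0) : Tendsto (fun k => state θ u k 0) atTop (𝓝 0) := by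
  rw [← tendsto_add_atTop_iff_nat s]
  have h1 : Tendsto (fun k => (transition θ ^ k *ᵥ state θ u s) 0) atTop
      (𝓝 (((0 : Matrix (Fin (n + 1)) (Fin (n + 1)) ℝ) *ᵥ state θ u s) 0)) := by
    have hc : Continuous fun M : Matrix (Fin (n + 1)) (Fin (n + 1)) ℝ => (M *ᵥ state θ u s) 0 :=
      (continuous_apply 0).comp (continuous_id.matrix_mulVec continuous_const)
    exact (hc.tendsto _).comp (tendsto_transition_pow h)
  simp only [zero_mulVec, Pi.zero_apply] at h1
  refine h1.congr fun k => ?_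
  rw [add_comm k s, state_add θ u k hu]

end State

/-! ### The spectral bound -/

section Spectral

open Matrix Filter Topology

variable {n : ℕ} (θ : EuclideanSpace ℝ (Fin n))

/-- The reversed characteristic polynomial `1 - θ_1 x - ⋯ - θ_n x ^ n`. -/
def revCharPoly : ℂ[X] := 1 - ∑ k : Fin n, C (θ k : ℂ) * X ^ ((k : ℕ) + 1)

variable {θ}

lemma norm_eval_revCharPoly (w : ℝ) :
    ‖(revCharPoly θ).eval (Complex.exp (w * Complex.I))‖
      = ‖aeval (Complex.exp ((-w : ℝ) * Complex.I)) (charPoly θ)‖ := by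
  set z := Complex.exp (w * Complex.I)
  have hz : Complex.exp ((-w : ℝ) * Complex.I) = z⁻¹ := by
    rw [← Complex.exp_neg]; push_cast; ring_nf
  have hz1 : ‖z‖ = 1 := Complex.norm_exp_ofReal_mul_I w
  have hz0 : z ≠ 0 := Complex.exp_ne_zero _
  have : (revCharPoly θ).eval z = z ^ n * aeval z⁻¹ (charPoly θ) := by
    rw [aeval_charPoly, mul_sub, inv_pow, mul_inv_cancel₀ (pow_ne_zero _ hz0), Finset.mul_sum]
    simp only [revCharPoly, eval_sub, eval_one, eval_finsetSum, eval_mul, eval_C, eval_pow, eval_X]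
    congr 1
    refine Finset.sum_congr rfl fun k _ => ?_
    have : z ^ n = z ^ ((k : ℕ) + 1) * z ^ (n - 1 - (k : ℕ)) := by
      rw [← pow_add]; congr 1; omega
    rw [this, inv_pow]
    field_simp
  rw [hz, this, norm_mul, norm_pow, hz1, one_pow, one_mul]

/-- A Schur polynomial has no zero on the compact unit circle. Boundedness makes the real `⨆` in
`MPhi` a genuine supremum instead of the default `0`. -/
lemma bddAbove_MPhi (h : IsSchur (charPoly θ)) : BddAbove (Set.range fun w : ℝ =>
    (‖aeval (Complex.exp (w * Complex.I)) (charPoly θ)‖ ^ 2)⁻¹) := by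
  have hcont : ContinuousOn (fun z : ℂ => (‖aeval z (charPoly θ)‖ ^ 2)⁻¹) (Metric.sphere 0 1) := by
    refine ContinuousOn.inv₀ (by fun_prop) fun z hz => ?_
    refine pow_ne_zero _ (norm_ne_zero_iff.2 fun h0 => ?_)
    have := h z h0
    simp at hz
    linarith
  refine ((isCompact_sphere (0 : ℂ) 1).bddAbove_image hcont).mono ?_
  rintro _ ⟨w, rfl⟩
  exact ⟨Complex.exp (w * Complex.I), by simp [Complex.norm_exp_ofReal_mul_I], rfl⟩

lemma aeval_charPoly_ne_zero (h : IsSchur (charPoly θ)) (w : ℝ) :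
    aeval (Complex.exp (w * Complex.I)) (charPoly θ) ≠ 0 := fun h0 => by
  have := h _ h0
  rw [Complex.norm_exp_ofReal_mul_I] at this
  exact lt_irrefl _ this

lemma MPhi_pos (h : IsSchur (charPoly θ)) : 0 < MPhi θ := by
  have h1 := norm_pos_iff.2 (aeval_charPoly_ne_zero h 0)
  exact lt_of_lt_of_le (by positivity) (le_ciSup (bddAbove_MPhi h) 0)

lemma one_le_MPhi_mul (h : IsSchur (charPoly θ)) {z : ℂ} (hz : ‖z‖ = 1) :
    1 ≤ MPhi θ * ‖(revCharPoly θ).eval z‖ ^ 2 := by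
  obtain ⟨w, rfl⟩ : ∃ w : ℝ, Complex.exp (w * Complex.I) = z :=
    (Complex.norm_eq_one_iff z).1 hz
  rw [norm_eval_revCharPoly]
  have h1 := norm_pos_iff.2 (aeval_charPoly_ne_zero h (-w))
  have h2 := le_ciSup (bddAbove_MPhi h) (-w)
  rw [← div_le_iff₀ (by positivity), one_div]
  exact h2

/-- Parseval on the unit circle, where `‖F‖ ^ 2 ≤ MPhi * ‖revCharPoly * F‖ ^ 2` holds pointwise. -/
lemma sum_sq_coeff_le (h : IsSchur (charPoly θ)) (F : ℂ[X]) :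
    ∑ i ∈ F.support, ‖F.coeff i‖ ^ 2
      ≤ MPhi θ * ∑ i ∈ (revCharPoly θ * F).support, ‖(revCharPoly θ * F).coeff i‖ ^ 2 := by
  rw [sum_sq_norm_coeff_eq_circleAverage, sum_sq_norm_coeff_eq_circleAverage, ← smul_eq_mul,
    ← Real.circleAverage_fun_smul]
  refine Real.circleAverage_mono ?_ ?_ ?_
  · exact (Continuous.continuousOn (by fun_prop)).circleIntegrable zero_le_one
  · exact (Continuous.continuousOn (by fun_prop)).circleIntegrable zero_le_one
  · intro z hz
    have hz1 : ‖z‖ = 1 := by simpa using hz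
    have := mul_le_mul_of_nonneg_right (one_le_MPhi_mul h hz1) (sq_nonneg ‖F.eval z‖)
    simp only [smul_eq_mul, eval_mul, norm_mul, mul_pow]
    linarith

/-- The generating polynomial of the first outputs. -/
def outputPoly (θ : EuclideanSpace ℝ (Fin n)) (u : ℕ → ℝ) (S : ℕ) : ℂ[X] :=
  ∑ s ∈ Finset.range (S + 1), C (state θ u s 0 : ℂ) * X ^ s

lemma coeff_outputPoly (u : ℕ → ℝ) (S j : ℕ) :
    (outputPoly θ u S).coeff j = if j ≤ S then (state θ u j 0 : ℂ) else 0 := by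
  simp [outputPoly, coeff_X_pow, Finset.sum_ite_eq]

lemma coeff_revCharPoly_mul (F : ℂ[X]) (j : ℕ) :
    (revCharPoly θ * F).coeff j
      = F.coeff j - ∑ k : Fin n, (θ k : ℂ) * if (k : ℕ) + 1 ≤ j then F.coeff (j - (k + 1)) else 0 := by
  simp only [revCharPoly, sub_mul, one_mul, coeff_sub, Finset.sum_mul, finsetSum_coeff, mul_assoc,
    coeff_C_mul, coeff_X_pow_mul']

lemma sum_support_eq_range {F : ℂ[X]} {m : ℕ} (h : ∀ j, m ≤ j → F.coeff j = 0) :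
    ∑ i ∈ F.support, ‖F.coeff i‖ ^ 2 = ∑ i ∈ Finset.range m, ‖F.coeff i‖ ^ 2 := by
  refine Finset.sum_subset (fun i hi => ?_) fun i _ hi => ?_
  · by_contra hc
    exact mem_support_iff.1 hi (h i (by simpa using hc))
  · simp [notMem_support_iff.1 hi]

/-- Multiplying the generating polynomial of the outputs by `revCharPoly` inverts the recursion and
returns the noise. Truncation at degree `S` spoils only the `n` coefficients above `S`, which form
the second sum. -/
lemma sum_sq_state_le_add (h : IsSchur (charPoly θ)) (u : ℕ → ℝ) (S : ℕ) :
    ∑ s ∈ Finset.range (S + 1), state θ u s 0 ^ 2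
      ≤ MPhi θ * (∑ r ∈ Finset.range S, u r ^ 2
        + ∑ i ∈ Finset.range n, (∑ k : Fin n, |θ k| * |state θ u (S + i - k) 0|) ^ 2) := by
  have key := sum_sq_coeff_le h (outputPoly θ u S)
  have hz : ∀ j, S + 1 + n ≤ j → (revCharPoly θ * outputPoly θ u S).coeff j = 0 := by
    intro j hj
    rw [coeff_revCharPoly_mul, coeff_outputPoly, if_neg (by omega), zero_sub, neg_eq_zero]
    refine Finset.sum_eq_zero fun k _ => ?_
    rw [coeff_outputPoly, if_neg (c := j - (k + 1) ≤ S) (by omega)]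
    simp
  rw [sum_support_eq_range (m := S + 1) (fun j hj => by
    rw [coeff_outputPoly, if_neg (by omega)]), sum_support_eq_range hz] at key
  refine le_trans (le_of_eq ?_) (key.trans (mul_le_mul_of_nonneg_left ?_ (MPhi_pos h).le))
  · refine Finset.sum_congr rfl fun s hs => ?_
    rw [coeff_outputPoly, if_pos (by simpa [Nat.lt_succ_iff] using hs)]
    simp
  · rw [Finset.sum_range_add _ (S + 1) n, Finset.sum_range_succ' _ S]
    refine add_le_add (le_of_eq ?_) (Finset.sum_le_sum fun i hi => ?_)
    · have h0 : (revCharPoly θ * outputPoly θ u S).coeff 0 = 0 := by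
        simp [coeff_outputPoly]
      rw [h0, norm_zero, zero_pow two_ne_zero, add_zero]
      refine Finset.sum_congr rfl fun r hr => ?_
      have hrS := Finset.mem_range.1 hr
      have : (revCharPoly θ * outputPoly θ u S).coeff (r + 1) = (u r : ℂ) := by
        rw [coeff_revCharPoly_mul, coeff_outputPoly, if_pos (by omega), state_succ_zero]
        push_cast
        rw [add_sub_right_comm, add_eq_right, sub_eq_zero]
        refine Finset.sum_congr rfl fun k _ => ?_
        rw [coeff_outputPoly, if_pos (c := r - (k : ℕ) ≤ S) (by omega)]
        split_ifs with hk
        · rfl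
        · rw [Nat.sub_eq_zero_of_le (by omega)]
          simp
      rw [this]
      simp
    · refine pow_le_pow_left₀ (norm_nonneg _) ?_ 2
      rw [coeff_revCharPoly_mul, coeff_outputPoly, if_neg (by omega), zero_sub, norm_neg]
      refine (norm_sum_le _ _).trans (Finset.sum_le_sum fun k _ => ?_)
      rw [norm_mul, Complex.norm_real, Real.norm_eq_abs]
      refine mul_le_mul_of_nonneg_left ?_ (abs_nonneg _)
      rw [coeff_outputPoly, show S + 1 + i - (k + 1) = S + i - k by omega]
      split_ifs <;> simp

/-- The `ℓ²` gain of the system is at most `MPhi`. -/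
lemma sum_sq_state_le (h : IsSchur (charPoly θ)) (u : ℕ → ℝ) (S : ℕ) :
    ∑ s ∈ Finset.range (S + 1), state θ u s 0 ^ 2 ≤ MPhi θ * ∑ r ∈ Finset.range S, u r ^ 2 := by
  -- With the noise switched off from time `S` on, the outputs decay. Truncating at `S + j` instead
  -- leaves the noise energy fixed while the boundary sum tends to `0`.
  set v : ℕ → ℝ := fun r => if r < S then u r else 0 with hv
  have huv : ∀ s ∈ Finset.range (S + 1), state θ u s 0 ^ 2 = state θ v s 0 ^ 2 := fun s hs => by
    rw [state_congr θ (v := v)]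
    intro r hr
    have := Finset.mem_range.1 hs
    simp [hv, show r < S by omega]
  have hsum (k : ℕ) : ∑ r ∈ Finset.range (S + k), v r ^ 2 = ∑ r ∈ Finset.range S, u r ^ 2 := by
    rw [Finset.sum_range_add, Finset.sum_eq_zero (s := Finset.range k) (by simp [hv]), add_zero]
    exact Finset.sum_congr rfl fun r hr => by simp [hv, Finset.mem_range.1 hr]
  rw [Finset.sum_congr rfl huv]
  have hlim0 := tendsto_state_of_eventually_zero h (u := v) (s := S)
    (fun r hr => by simp [hv, not_lt.2 hr])
  have hlim : Tendsto (fun j => MPhi θ * (∑ r ∈ Finset.range S, u r ^ 2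
      + ∑ i ∈ Finset.range n, (∑ k : Fin n, |θ k| * |state θ v (S + j + i - k) 0|) ^ 2)) atTop
      (𝓝 (MPhi θ * (∑ r ∈ Finset.range S, u r ^ 2
        + ∑ i ∈ Finset.range n, (∑ k : Fin n, |θ k| * |(0 : ℝ)|) ^ 2))) := by
    refine (tendsto_const_nhds.add (tendsto_finsetSum _ fun i _ =>
      (tendsto_finsetSum _ fun k _ => ?_).pow 2)).const_mul _
    refine Tendsto.const_mul _ (Tendsto.abs (hlim0.comp ?_))
    refine tendsto_atTop.2 fun b => ?_
    filter_upwards [eventually_ge_atTop (b + k)] with j hj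
    omega
  simp only [abs_zero, mul_zero, Finset.sum_const_zero, ne_eq, OfNat.ofNat_ne_zero,
    not_false_eq_true, zero_pow, add_zero] at hlim
  refine ge_of_tendsto' hlim fun j => ?_
  have := sum_sq_state_le_add h v (S + j)
  rw [hsum] at this
  refine le_trans ?_ this
  exact Finset.sum_le_sum_of_subset_of_nonneg (Finset.range_mono (by omega))
    fun _ _ _ => sq_nonneg _

end Spectral

/-! ### Laws of linear functions of Gaussian white noise -/

section Laws

open Real

variable {Ω : Type*} [MeasurableSpace Ω] {P : Measure Ω} [IsProbabilityMeasure P]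
  {w : ℕ → Ω → ℝ} {σ : ℝ}

lemma map_div_eq_pi (hσ : 0 < σ) (hind : iIndepFun w P)
    (hlaw : ∀ s, HasLaw (w s) (gaussianReal 0 (toNNReal (σ ^ 2))) P)
    {H : ℕ} {f : Fin H → ℕ} (hf : f.Injective) :
    HasLaw (fun ω i => w (f i) ω / σ) (Measure.pi fun _ : Fin H => gaussianReal 0 1) P := by
  have hone (s) : HasLaw (fun ω => w s ω / σ) (gaussianReal 0 1) P := by
    have := gaussianReal_div_const (hlaw s) σ
    convert this using 2
    · simp
    · ext
      simp [hσ.le, hσ.ne']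
  have hi : iIndepFun (fun (i : Fin H) ω => w (f i) ω / σ) P :=
    (hind.precomp hf).comp (fun _ x => x / σ) fun _ => measurable_id.div_const σ
  refine ⟨aemeasurable_pi_lambda _ fun i => (hone (f i)).aemeasurable, ?_⟩
  rw [(iIndepFun_iff_map_fun_eq_pi_map fun i => (hone (f i)).aemeasurable).1 hi]
  congr 1
  ext1 i
  exact (hone (f i)).map_eq

lemma hasLaw_toLp_stdGaussian (hσ : 0 < σ) (hind : iIndepFun w P)
    (hlaw : ∀ s, HasLaw (w s) (gaussianReal 0 (toNNReal (σ ^ 2))) P) (H : ℕ) :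
    HasLaw (fun ω => WithLp.toLp 2 fun i : Fin H => w i ω / σ)
      (stdGaussian (EuclideanSpace ℝ (Fin H))) P := by
  have h1 := map_div_eq_pi hσ hind hlaw (f := fun i : Fin H => (i : ℕ)) Fin.val_injective
  have h2 : HasLaw (WithLp.toLp 2) (stdGaussian (EuclideanSpace ℝ (Fin H)))
      (Measure.pi fun _ : Fin H => gaussianReal 0 1) :=
    ⟨by fun_prop, map_pi_eq_stdGaussian⟩
  exact h2.comp h1

lemma hasLaw_sum_gaussian (hm : ∀ s, Measurable (w s)) (hind : iIndepFun w P)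
    (hlaw : ∀ s, HasLaw (w s) (gaussianReal 0 (toNNReal (σ ^ 2))) P) (a : ℕ → ℝ) (s : ℕ) :
    HasLaw (fun ω => ∑ r ∈ Finset.range s, a r * w r ω)
      (gaussianReal 0 (toNNReal (σ ^ 2 * ∑ r ∈ Finset.range s, a r ^ 2))) P := by
  induction s with
  | zero =>
    refine ⟨by fun_prop, ?_⟩
    simp [gaussianReal_zero_var]
  | succ s ih =>
    have h1 := gaussianReal_const_mul (hlaw s) (a s)
    have hi : IndepFun (fun ω => ∑ r ∈ Finset.range s, a r * w r ω) (fun ω => a s * w s ω) P := by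
      have := (hind.comp (fun r x => a r * x) fun r => measurable_const_mul (a r))
        |>.indepFun_finsetSum_of_notMem (fun r => (hm r).const_mul (a r))
          (s := Finset.range s) (i := s) (by simp)
      have e : (∑ j ∈ Finset.range s, (fun x => a j * x) ∘ w j)
          = fun ω => ∑ r ∈ Finset.range s, a r * w r ω := by
        ext ω
        simp
      rwa [e] at this
    have := gaussianReal_add_gaussianReal_of_indepFun hi ih.map_eq h1.map_eq
    refine ⟨by fun_prop, ?_⟩
    simp only [Finset.sum_range_succ]
    refine this.trans ?_
    congr 1
    · simp
    · ext
      have : 0 ≤ σ ^ 2 * ∑ r ∈ Finset.range s, a r ^ 2 := by positivity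
      have h2 : 0 ≤ σ ^ 2 * (∑ r ∈ Finset.range s, a r ^ 2 + a s ^ 2) := by positivity
      simp [this, h2, sq_nonneg]
      ring

variable {n : ℕ} {θ : EuclideanSpace ℝ (Fin n)}

lemma hasLaw_state_zero (hm : ∀ s, Measurable (w s)) (hind : iIndepFun w P)
    (hlaw : ∀ s, HasLaw (w s) (gaussianReal 0 (toNNReal (σ ^ 2))) P) (s : ℕ) :
    HasLaw (fun ω => state θ (fun r => w r ω) s 0)
      (gaussianReal 0 (toNNReal (σ ^ 2 * ∑ k ∈ Finset.range s, impulse θ k ^ 2))) P := by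
  simp only [state_apply_zero]
  rw [← Finset.sum_range_reflect (fun k => impulse θ k ^ 2)]
  exact hasLaw_sum_gaussian hm hind hlaw (fun r => impulse θ (s - 1 - r)) s

/-- Tail of a sum of squares of centred Gaussian variables, without independence. -/
lemma measure_sum_sq_ge_le {k : ℕ} (hk : 0 < k) {Y : Fin k → Ω → ℝ} {v : Fin k → NNReal} {m : ℝ}
    (hm : 0 < m) (hv : ∀ i, v i ≤ m) (hY : ∀ i, HasLaw (Y i) (gaussianReal 0 (v i)) P) (c : ℝ) :
    P.real {ω | c ≤ ∑ i, Y i ω ^ 2} ≤ √2 * exp (-c / (4 * k * m)) := by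
  have hk' : (0 : ℝ) < k := by exact_mod_cast hk
  -- With this exponent `1 - 2 l v i ≥ 1 / 2`, so every moment `E exp(l Y²)` is at most `√2`.
  set l : ℝ := 1 / (4 * m) with hl
  have hvl (i) : 2 * l * v i ≤ 1 / 2 := by
    rw [hl, mul_one_div, div_mul_eq_mul_div, div_le_iff₀ (by positivity)]
    linarith [hv i]
  have hint (i) : Integrable (fun ω => exp (l * Y i ω ^ 2)) P := by
    have h1 := integrable_exp_sq_gaussianReal (v := v i) (s := l) (by linarith [hvl i])
    rw [← (hY i).map_eq] at h1
    exact h1.comp_aemeasurable (hY i).aemeasurable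
  have hval (i) : ∫ ω, exp (l * Y i ω ^ 2) ∂P ≤ √2 := by
    have h1 := integral_exp_sq_gaussianReal (v := v i) (s := l) (by linarith [hvl i])
    rw [← (hY i).map_eq, integral_map (hY i).aemeasurable
      (Continuous.aestronglyMeasurable (by fun_prop))] at h1
    rw [h1, ← sqrt_inv]
    refine sqrt_le_sqrt ?_
    rw [inv_le_comm₀ (by linarith [hvl i]) two_pos]
    linarith [hvl i]
  -- Jensen with equal weights takes the place of independence, at the price of the factor `k` in
  -- the exponent.
  have hconv (ω) : exp (l / k * ∑ i, Y i ω ^ 2) ≤ ∑ i, (1 / k : ℝ) * exp (l * Y i ω ^ 2) := by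
    have := convexOn_exp.map_sum_le (t := Finset.univ) (w := fun _ : Fin k => (1 / k : ℝ))
      (p := fun i => l * Y i ω ^ 2) (fun _ _ => by positivity) (by simp [hk'.ne']) (by simp)
    simp only [smul_eq_mul] at this
    refine le_trans (le_of_eq ?_) this
    rw [Finset.mul_sum]
    congr 1
    exact Finset.sum_congr rfl fun i _ => by ring
  have hmeas : AEMeasurable (fun ω => ∑ i, Y i ω ^ 2) P :=
    Finset.aemeasurable_fun_sum _ fun i _ => (hY i).aemeasurable.pow_const 2
  have hintR : Integrable (fun ω => ∑ i, (1 / k : ℝ) * exp (l * Y i ω ^ 2)) P :=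
    integrable_finsetSum _ fun i _ => (hint i).const_mul _
  have hintS : Integrable (fun ω => exp (l / k * ∑ i, Y i ω ^ 2)) P := by
    refine hintR.mono' (measurable_exp.comp_aemeasurable (hmeas.const_mul _)).aestronglyMeasurable
      (ae_of_all _ fun ω => ?_)
    rw [norm_of_nonneg (exp_pos _).le]
    exact hconv ω
  have hmgf : mgf (fun ω => ∑ i, Y i ω ^ 2) P (l / k) ≤ √2 := by
    rw [mgf]
    refine (integral_mono hintS hintR hconv).trans ?_
    rw [integral_finsetSum _ fun i _ => (hint i).const_mul _]
    simp only [integral_const_mul]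
    calc ∑ i, (1 / k : ℝ) * ∫ ω, exp (l * Y i ω ^ 2) ∂P ≤ ∑ _i : Fin k, (1 / k : ℝ) * √2 := by
          gcongr with i
          exact hval i
      _ = √2 := by simp [hk'.ne']
  refine (measure_ge_le_exp_mul_mgf c (by positivity) hintS).trans ?_
  rw [mul_comm]
  refine mul_le_mul hmgf (le_of_eq ?_) (exp_pos _).le (sqrt_nonneg _)
  congr 1
  rw [hl]
  field_simp

/-- Chi-square concentration for the noise. -/
lemma measure_noise_sq_ge_le (hσ : 0 < σ) (hind : iIndepFun w P)
    (hlaw : ∀ s, HasLaw (w s) (gaussianReal 0 (toNNReal (σ ^ 2))) P) (T : ℕ) {K : ℕ} (hK : 0 < K)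
    {ε : ℝ} (hε : 0 < ε) :
    P.real {ω | K * σ ^ 2 * (ε / 3) < |∑ k ∈ Finset.range K, w (T + k) ω ^ 2 - K * σ ^ 2|}
      ≤ 2 * exp (-(K / 2) * (1 + ε / 3 - √(1 + 2 * ε / 3))) := by
  have hK' : (0 : ℝ) < K := by exact_mod_cast hK
  have : Nonempty (Fin K) := ⟨⟨0, hK⟩⟩
  have hl := map_div_eq_pi hσ hind hlaw (f := fun i : Fin K => T + i)
    (fun i j h => Fin.ext (by simpa using h))
  set d := √(1 + 2 * ε / 3) with hd
  have hd2 : d ^ 2 = 1 + 2 * ε / 3 := sq_sqrt (by positivity)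
  have hd1 : 1 ≤ d := by rw [hd, one_le_sqrt]; linarith
  -- Chosen so that `2√(Kx) + 2x = K ε / 3`, the upper-tail deviation. The lower tail needs only
  -- `2√(Kx)`, which is smaller.
  set x := K / 2 * (1 + ε / 3 - d) with hx
  have hxs : x = K * ((d - 1) / 2) ^ 2 := by rw [hx]; nlinarith
  have hx0 : 0 ≤ x := by rw [hxs]; positivity
  have hsq : √(K * x) = K * ((d - 1) / 2) := by
    rw [hxs, show (K : ℝ) * (K * ((d - 1) / 2) ^ 2) = (K * ((d - 1) / 2)) ^ 2 by ring]
    exact sqrt_sq (mul_nonneg hK'.le (by linarith))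
  have hup := pi_gaussian_upper_tail (ι := Fin K) (μ := fun _ => 1) (M := 1) (τ := K) (K := K)
    one_pos hK' hx0 (by simp) (by simp) (by simp) (by simp)
  have hlo := pi_gaussian_lower_tail (ι := Fin K) hx0
  simp only [mul_one, one_mul, Fintype.card_fin] at hup hlo
  have hsum (ω) : ∑ k ∈ Finset.range K, w (T + k) ω ^ 2
      = σ ^ 2 * ∑ i : Fin K, (w (T + i) ω / σ) ^ 2 := by
    rw [← Fin.sum_univ_eq_sum_range (fun k => w (T + k) ω ^ 2), Finset.mul_sum]
    refine Finset.sum_congr rfl fun i _ => ?_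
    field_simp
  have hc : Continuous fun g : Fin K → ℝ => ∑ i, g i ^ 2 := by fun_prop
  rw [← hl.map_eq] at hup hlo
  rw [measureReal_def, Measure.map_apply_of_aemeasurable hl.aemeasurable
    (isClosed_le continuous_const hc).measurableSet, ← measureReal_def] at hup
  rw [measureReal_def, Measure.map_apply_of_aemeasurable hl.aemeasurable
    (isClosed_le hc continuous_const).measurableSet, ← measureReal_def] at hlo
  have hσ2 : 0 < σ ^ 2 := by positivity
  refine (measureReal_mono ?_ (by finiteness)).trans
    ((measureReal_union_le _ _).trans (add_le_add hup hlo) |>.trans (le_of_eq ?_))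
  · intro ω hω
    simp only [Set.mem_ofPred_eq, hsum, lt_abs] at hω
    simp only [Set.mem_union, Set.mem_preimage, Set.mem_ofPred_eq]
    rw [hsq]
    have e1 : 2 * (K * ((d - 1) / 2)) + 2 * x = K * (ε / 3) := by rw [hx]; ring
    rcases hω with hω | hω
    · left
      refine le_of_mul_le_mul_left ?_ hσ2
      nlinarith
    · right
      refine le_of_mul_le_mul_left ?_ hσ2
      nlinarith
  · rw [← two_mul, hx, neg_mul]

end Laws

/-! ### The energy of the output -/

section Energy

open Real

variable {n : ℕ} {θ : EuclideanSpace ℝ (Fin n)}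

lemma state_noise_add (u v : ℕ → ℝ) (s : ℕ) : state θ (u + v) s = state θ u s + state θ v s := by
  induction s with
  | zero => simp
  | succ s ih =>
    rw [state_succ, state_succ, state_succ, ih, Matrix.mulVec_add, Pi.add_apply, add_smul]
    abel

lemma state_noise_smul (a : ℝ) (u : ℕ → ℝ) (s : ℕ) : state θ (a • u) s = a • state θ u s := by
  induction s with
  | zero => simp
  | succ s ih =>
    rw [state_succ, state_succ, ih, Matrix.mulVec_smul, Pi.smul_apply, smul_add, smul_eq_mul,
      mul_smul]

/-- Extension of a finite noise vector by zero. -/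
def zeroExtend {H : ℕ} (g : Fin H → ℝ) (r : ℕ) : ℝ := if h : r < H then g ⟨r, h⟩ else 0

lemma zeroExtend_add {H : ℕ} (g k : Fin H → ℝ) :
    zeroExtend (g + k) = zeroExtend g + zeroExtend k := by
  ext r
  by_cases h : r < H <;> simp [zeroExtend, h]

lemma zeroExtend_smul {H : ℕ} (a : ℝ) (g : Fin H → ℝ) :
    zeroExtend (a • g) = a • zeroExtend g := by
  ext r
  by_cases h : r < H <;> simp [zeroExtend, h]

/-- The map from the noise to a window of outputs. -/
def outputMap (θ : EuclideanSpace ℝ (Fin n)) (T N : ℕ) :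
    EuclideanSpace ℝ (Fin (T + N)) →ₗ[ℝ] EuclideanSpace ℝ (Fin N) where
  toFun g := WithLp.toLp 2 fun t => state θ (zeroExtend g.ofLp) (T + t) 0
  map_add' g k := by
    ext t
    simp [zeroExtend_add, state_noise_add]
  map_smul' a g := by
    ext t
    simp [zeroExtend_smul, state_noise_smul]

lemma norm_sq_outputMap (T N : ℕ) (g : EuclideanSpace ℝ (Fin (T + N))) :
    ‖outputMap θ T N g‖ ^ 2
      = ∑ t ∈ Finset.range N, state θ (zeroExtend g.ofLp) (T + t) 0 ^ 2 := by
  rw [EuclideanSpace.real_norm_sq_eq,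
    ← Fin.sum_univ_eq_sum_range (fun t => state θ (zeroExtend g.ofLp) (T + t) 0 ^ 2)]
  rfl

lemma norm_sq_outputMap_le (h : IsSchur (charPoly θ)) (T N : ℕ)
    (g : EuclideanSpace ℝ (Fin (T + N))) :
    ‖outputMap θ T N g‖ ^ 2 ≤ MPhi θ * ‖g‖ ^ 2 := by
  have h1 := sum_sq_state_le h (zeroExtend g.ofLp) (T + N)
  have h2 : ∑ r ∈ Finset.range (T + N), zeroExtend g.ofLp r ^ 2 = ‖g‖ ^ 2 := by
    rw [EuclideanSpace.real_norm_sq_eq, ← Fin.sum_univ_eq_sum_range]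
    simp [zeroExtend]
  rw [h2] at h1
  refine le_trans ?_ h1
  rw [norm_sq_outputMap, Finset.sum_range_succ, Finset.sum_range_add]
  have h3 : 0 ≤ ∑ s ∈ Finset.range T, state θ (zeroExtend g.ofLp) s 0 ^ 2 :=
    Finset.sum_nonneg fun _ _ => sq_nonneg _
  nlinarith [sq_nonneg (state θ (zeroExtend g.ofLp) (T + N) 0)]

lemma state_single_zero (s r : ℕ) :
    state θ (Pi.single r 1) s 0 = if r < s then impulse θ (s - 1 - r) else 0 := by
  rw [state_apply_zero]
  split_ifs with h
  · rw [Finset.sum_eq_single_of_mem r (by simpa using h) fun j _ hj => by simp [hj]]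
    simp
  · refine Finset.sum_eq_zero fun j hj => ?_
    rw [Pi.single_eq_of_ne (by have := Finset.mem_range.1 hj; omega), mul_zero]

lemma sum_sq_impulse_le (h : IsSchur (charPoly θ)) (s : ℕ) :
    ∑ k ∈ Finset.range s, impulse θ k ^ 2 ≤ MPhi θ := by
  have h1 := sum_sq_state_le h (Pi.single 0 1) s
  rw [Finset.sum_range_succ'] at h1
  simp only [state_single_zero] at h1
  rcases Nat.eq_zero_or_pos s with rfl | hs
  · simpa using (MPhi_pos h).le
  · have e : ∑ r ∈ Finset.range s, (Pi.single 0 1 : ℕ → ℝ) r ^ 2 = 1 := by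
      rw [Finset.sum_eq_single_of_mem 0 (by simpa using hs) fun j _ hj => by simp [hj]]
      simp
    rw [e] at h1
    simpa using h1

/-- The sum is the trace of `C* C` for `C = outputMap θ T N`; exchanging sums, each of the `N`
outputs contributes a partial sum of squared impulse coefficients. It is used with `τ = m / σ ^ 2`
for the mean and with `τ = MPhi θ` for the variance proxy. -/
lemma sum_norm_sq_outputMap_single_le {τ : ℝ}
    (hτ : ∀ s, ∑ k ∈ Finset.range s, impulse θ k ^ 2 ≤ τ) (T N : ℕ) :
    ∑ i, ‖outputMap θ T N (EuclideanSpace.basisFun (Fin (T + N)) ℝ i)‖ ^ 2 ≤ N * τ := by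
  simp only [norm_sq_outputMap]
  rw [Finset.sum_comm]
  calc _ ≤ ∑ _t ∈ Finset.range N, τ := Finset.sum_le_sum fun t ht => ?_
    _ = N * τ := by simp
  have ht' := Finset.mem_range.1 ht
  have hz (i : Fin (T + N)) :
      zeroExtend (EuclideanSpace.basisFun (Fin (T + N)) ℝ i).ofLp = Pi.single (i : ℕ) 1 := by
    ext r
    by_cases hr : r < T + N
    · simp [zeroExtend, hr, Pi.single_apply, Fin.ext_iff]
    · have : r ≠ i := by omega
      simp [zeroExtend, hr, this]
  simp only [hz, state_single_zero]
  rw [Fin.sum_univ_eq_sum_range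
    (fun r => (if r < T + t then impulse θ (T + t - 1 - r) else 0) ^ 2) (T + N)]
  refine le_trans (le_of_eq ?_) (hτ (T + t))
  rw [← Finset.sum_range_reflect (fun k => impulse θ k ^ 2)]
  symm
  refine Finset.sum_subset_zero_on_sdiff (Finset.range_mono (by omega)) (fun r hr => ?_)
    fun r hr => ?_
  · simp at hr
    simp [not_lt.2 hr.2]
  · rw [if_pos (by simpa using hr)]

variable {Ω : Type*} [MeasurableSpace Ω] {P : Measure Ω} [IsProbabilityMeasure P]
  {w : ℕ → Ω → ℝ} {σ : ℝ}

/-- Upper tail of the energy of a window of outputs. -/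
lemma measure_energy_ge_le (h : IsSchur (charPoly θ)) (hσ : 0 < σ) (hind : iIndepFun w P)
    (hlaw : ∀ s, HasLaw (w s) (gaussianReal 0 (toNNReal (σ ^ 2))) P) {m : ℝ}
    (hm : ∀ s, σ ^ 2 * ∑ k ∈ Finset.range s, impulse θ k ^ 2 ≤ m) (T : ℕ) {N : ℕ} (hN : 0 < N)
    {x : ℝ} (hx : 0 ≤ x) :
    P.real {ω | N * m + 2 * (σ ^ 2 * MPhi θ) * √(N * x) + 2 * (σ ^ 2 * MPhi θ) * x
      ≤ ∑ t ∈ Finset.range N, state θ (fun r => w r ω) (T + t) 0 ^ 2} ≤ exp (-x) := by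
  have hl := hasLaw_toLp_stdGaussian hσ hind hlaw (T + N)
  have hN' : (0 : ℝ) < N := by exact_mod_cast hN
  have hσ2 : 0 < σ ^ 2 := by positivity
  have hτ : ∀ s, ∑ k ∈ Finset.range s, impulse θ k ^ 2 ≤ m / σ ^ 2 := fun s => by
    rw [le_div_iff₀ hσ2, mul_comm]; exact hm s
  have ht := stdGaussian_norm_sq_upper_tail (outputMap θ T N)
    (EuclideanSpace.basisFun (Fin (T + N)) ℝ) (MPhi_pos h) hN' hx (norm_sq_outputMap_le h T N)
    (sum_norm_sq_outputMap_single_le hτ T N)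
    (sum_norm_sq_outputMap_single_le (sum_sq_impulse_le h) T N)
  have hC : Continuous (outputMap θ T N) := LinearMap.continuous_of_finiteDimensional _
  rw [← hl.map_eq, measureReal_def, Measure.map_apply_of_aemeasurable hl.aemeasurable
    (isClosed_le continuous_const (by fun_prop)).measurableSet, ← measureReal_def] at ht
  refine le_trans (measureReal_mono (fun ω hω => ?_) (by finiteness)) ht
  simp only [Set.mem_preimage, Set.mem_ofPred_eq, norm_sq_outputMap] at hω ⊢
  have hs : ∀ t ∈ Finset.range N, state θ (fun r => w r ω) (T + t) 0 ^ 2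
      = σ ^ 2 * state θ (zeroExtend fun i : Fin (T + N) => w i ω / σ) (T + t) 0 ^ 2 := by
    intro t ht
    have ht' := Finset.mem_range.1 ht
    have : state θ (fun r => w r ω) (T + t)
        = state θ (σ • zeroExtend fun i : Fin (T + N) => w i ω / σ) (T + t) := by
      refine state_congr θ fun r hr => ?_
      simp [zeroExtend, show r < T + N by omega]
      field_simp
    rw [this, state_noise_smul, Pi.smul_apply, smul_eq_mul, mul_pow]
  rw [Finset.sum_congr rfl hs, ← Finset.mul_sum] at hω
  refine le_of_mul_le_mul_left (le_trans (le_of_eq ?_) hω) hσ2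
  field_simp

end Energy

/-! ### The exponential supermartingale -/

section Supermartingale

open Real

variable {Ω : Type*} [mΩ : MeasurableSpace Ω] {P : Measure Ω} [IsProbabilityMeasure P]
  {E : Type*} [NormedAddCommGroup E] [InnerProductSpace ℝ E] [MeasurableSpace E] [BorelSpace E]
  [SecondCountableTopology E]

/-- One supermartingale step: by independence and Tonelli the fresh Gaussian is integrated out
first, and the factor `exp (v‖b‖² / 2)` it produces is cancelled by the growth of the bracket. -/
lemma lintegral_cosh_step {a b : Ω → E} {q ξ : Ω → ℝ} {v : NNReal} (ha : Measurable a)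
    (hb : Measurable b) (hq : Measurable q) (hξ : Measurable ξ)
    (hlaw : HasLaw ξ (gaussianReal 0 v) P) (hind : IndepFun (fun ω => (a ω, b ω, q ω)) ξ P) :
    ∫⁻ ω, ENNReal.ofReal (cosh ‖a ω + ξ ω • b ω‖ * exp (-(v * (q ω + ‖b ω‖ ^ 2) / 2))) ∂P
      ≤ ∫⁻ ω, ENNReal.ofReal (cosh ‖a ω‖ * exp (-(v * q ω / 2))) ∂P := by
  have hh : Measurable fun ω => (a ω, b ω, q ω) := ha.prodMk (hb.prodMk hq)
  set G : (E × E × ℝ) × ℝ → ENNReal := fun p => ENNReal.ofReal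
    (cosh ‖p.1.1 + p.2 • p.1.2.1‖ * exp (-(v * (p.1.2.2 + ‖p.1.2.1‖ ^ 2) / 2))) with hG
  have hGm : Measurable G := by
    refine Measurable.ennreal_ofReal (Continuous.measurable ?_)
    refine Continuous.mul (continuous_cosh.comp (by fun_prop)) (by fun_prop)
  have h1 := (indepFun_iff_map_prod_eq_prod_map_map hh.aemeasurable hξ.aemeasurable).1 hind
  calc _ = ∫⁻ p, G p ∂(P.map fun ω => ((a ω, b ω, q ω), ξ ω)) := by
        rw [lintegral_map hGm (hh.prodMk hξ)]
    _ = ∫⁻ p, ∫⁻ e, G (p, e) ∂(gaussianReal 0 v) ∂(P.map fun ω => (a ω, b ω, q ω)) := by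
        have : IsProbabilityMeasure (P.map fun ω => (a ω, b ω, q ω)) :=
          Measure.isProbabilityMeasure_map hh.aemeasurable
        rw [h1, hlaw.map_eq, lintegral_prod _ hGm.aemeasurable]
    _ ≤ ∫⁻ p : E × E × ℝ, ENNReal.ofReal (cosh ‖p.1‖ * exp (-(v * p.2.2 / 2)))
          ∂(P.map fun ω => (a ω, b ω, q ω)) := by
        refine lintegral_mono fun p => ?_
        simp only [hG]
        have hp := (exp_pos (-(v * (p.2.2 + ‖p.2.1‖ ^ 2) / 2))).le
        calc _ = ∫⁻ e, ENNReal.ofReal (cosh ‖p.1 + e • p.2.1‖)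
              * ENNReal.ofReal (exp (-(v * (p.2.2 + ‖p.2.1‖ ^ 2) / 2))) ∂(gaussianReal 0 v) := by
              refine lintegral_congr fun e => ?_
              rw [ENNReal.ofReal_mul (cosh_pos _).le]
          _ = (∫⁻ e, ENNReal.ofReal (cosh ‖p.1 + e • p.2.1‖) ∂(gaussianReal 0 v))
              * ENNReal.ofReal (exp (-(v * (p.2.2 + ‖p.2.1‖ ^ 2) / 2))) :=
              lintegral_mul_const' _ _ ENNReal.ofReal_ne_top
          _ ≤ _ := mul_le_mul_left (lintegral_cosh_norm_gaussianReal_le v p.1 p.2.1) _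
          _ = _ := by
              rw [← ENNReal.ofReal_mul (by positivity), mul_assoc, ← exp_add]
              congr 4
              ring
    _ = _ := by
        rw [lintegral_map _ hh]
        refine Measurable.ennreal_ofReal (Continuous.measurable ?_)
        exact Continuous.mul (continuous_cosh.comp (by fun_prop)) (by fun_prop)

/-- Exponential supermartingale of a Gaussian martingale transform. -/
lemma lintegral_cosh_sum_le_one {ℱ : ℕ → MeasurableSpace Ω} (hℱ : ∀ k, ℱ k ≤ mΩ)
    (hmono : Monotone ℱ) {X : ℕ → Ω → E} {ξ : ℕ → Ω → ℝ} {v : NNReal}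
    (hX : ∀ k, Measurable[ℱ k] (X k)) (hξ : ∀ k, Measurable[ℱ (k + 1)] (ξ k))
    (hlaw : ∀ k, HasLaw (ξ k) (gaussianReal 0 v) P)
    (hind : ∀ k, Indep (ℱ k) (MeasurableSpace.comap (ξ k) inferInstance) P) (K : ℕ) :
    ∫⁻ ω, ENNReal.ofReal (cosh ‖∑ k ∈ Finset.range K, ξ k ω • X k ω‖
      * exp (-(v * (∑ k ∈ Finset.range K, ‖X k ω‖ ^ 2) / 2))) ∂P ≤ 1 := by
  induction K with
  | zero => simp
  | succ K ih =>
    have hXK (k) (hk : k ≤ K) : Measurable[ℱ K] (X k) := (hX k).mono (hmono hk) le_rfl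
    have hξK (k) (hk : k < K) : Measurable[ℱ K] (ξ k) :=
      (hξ k).mono (hmono (Nat.succ_le_of_lt hk)) le_rfl
    have ha : Measurable[ℱ K] fun ω => ∑ k ∈ Finset.range K, ξ k ω • X k ω :=
      Finset.measurable_fun_sum _ fun k hk => (hξK k (Finset.mem_range.1 hk)).smul
        (hXK k (Finset.mem_range.1 hk).le)
    have hq : Measurable[ℱ K] fun ω => ∑ k ∈ Finset.range K, ‖X k ω‖ ^ 2 :=
      Finset.measurable_fun_sum _ fun k hk =>
        (measurable_norm.pow_const 2).comp (hXK k (Finset.mem_range.1 hk).le)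
    have hpair : Measurable[ℱ K] fun ω => (∑ k ∈ Finset.range K, ξ k ω • X k ω, X K ω,
        ∑ k ∈ Finset.range K, ‖X k ω‖ ^ 2) := ha.prodMk ((hX K).prodMk hq)
    have hi : IndepFun (fun ω => (∑ k ∈ Finset.range K, ξ k ω • X k ω, X K ω,
        ∑ k ∈ Finset.range K, ‖X k ω‖ ^ 2)) (ξ K) P :=
      indep_of_indep_of_le_left (hind K) (measurable_iff_comap_le.1 hpair)
    refine le_trans (le_of_eq ?_) ((lintegral_cosh_step (ha.mono (hℱ K) le_rfl)
      ((hX K).mono (hℱ K) le_rfl) (hq.mono (hℱ K) le_rfl) ((hξ K).mono (hℱ _) le_rfl)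
      (hlaw K) hi).trans ih)
    simp only [Finset.sum_range_succ]

/-- Pinelis-type deviation bound for Gaussian martingale transforms with bounded bracket. -/
lemma measure_norm_sum_ge_le {ℱ : ℕ → MeasurableSpace Ω} (hℱ : ∀ k, ℱ k ≤ mΩ)
    (hmono : Monotone ℱ) {X : ℕ → Ω → E} {ξ : ℕ → Ω → ℝ} {v : NNReal} (hv : v ≠ 0)
    (hX : ∀ k, Measurable[ℱ k] (X k)) (hξ : ∀ k, Measurable[ℱ (k + 1)] (ξ k))
    (hlaw : ∀ k, HasLaw (ξ k) (gaussianReal 0 v) P)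
    (hind : ∀ k, Indep (ℱ k) (MeasurableSpace.comap (ξ k) inferInstance) P) (K : ℕ)
    {c β : ℝ} (hc : 0 < c) (hβ : 0 < β) :
    P.real {ω | c ≤ ‖∑ k ∈ Finset.range K, ξ k ω • X k ω‖ ∧
      ∑ k ∈ Finset.range K, ‖X k ω‖ ^ 2 ≤ β} ≤ 2 * exp (-(c ^ 2 / (2 * v * β))) := by
  have hv0 : (0 : ℝ) < v := by positivity
  -- Maximises `l c - v l² β / 2`, giving `c² / (2 v β)`; the final factor `2` comes from `cosh t ≥
  -- exp t / 2`.
  set l := c / (v * β) with hl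
  have hl0 : 0 < l := by positivity
  have hm := lintegral_cosh_sum_le_one hℱ hmono (X := fun k ω => l • X k ω)
    (fun k => (hX k).const_smul l) hξ hlaw hind K
  simp only [smul_comm _ l, ← Finset.smul_sum, norm_smul, norm_of_nonneg hl0.le, mul_pow,
    ← Finset.mul_sum] at hm
  set Z : Ω → ENNReal := fun ω => ENNReal.ofReal (cosh (l * ‖∑ k ∈ Finset.range K, ξ k ω • X k ω‖)
      * exp (-(v * (l ^ 2 * ∑ k ∈ Finset.range K, ‖X k ω‖ ^ 2) / 2))) with hZ
  have hX' (k) : Measurable (X k) := (hX k).mono (hℱ k) le_rfl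
  have hξ' (k) : Measurable (ξ k) := (hξ k).mono (hℱ _) le_rfl
  have hZm : Measurable Z := by
    refine Measurable.ennreal_ofReal ((measurable_cosh.comp ?_).mul ?_)
    · exact (Finset.measurable_fun_sum _ fun k _ => (hξ' k).smul (hX' k)).norm.const_mul _
    · refine measurable_exp.comp (Measurable.neg ((Measurable.const_mul ?_ _).div_const _))
      exact (Finset.measurable_fun_sum _ fun k _ => (hX' k).norm.pow_const 2).const_mul _
  set t : ℝ := cosh (l * c) * exp (-(v * (l ^ 2 * β) / 2)) with ht
  have ht0 : 0 < t := by positivity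
  have hsub : {ω | c ≤ ‖∑ k ∈ Finset.range K, ξ k ω • X k ω‖ ∧
      ∑ k ∈ Finset.range K, ‖X k ω‖ ^ 2 ≤ β} ⊆ {ω | ENNReal.ofReal t ≤ Z ω} := by
    rintro ω ⟨h1, h2⟩
    refine ENNReal.ofReal_le_ofReal (mul_le_mul ?_ ?_ (exp_pos _).le (cosh_pos _).le)
    · rw [cosh_le_cosh, abs_of_nonneg (by positivity), abs_of_nonneg (by positivity)]
      gcongr
    · gcongr
  have hmk := mul_meas_ge_le_lintegral (μ := P) hZm (ENNReal.ofReal t)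
  have h1 : P {ω | ENNReal.ofReal t ≤ Z ω} ≤ ENNReal.ofReal t⁻¹ := by
    rw [ENNReal.ofReal_inv_of_pos ht0, ENNReal.le_inv_iff_mul_le, mul_comm]
    exact hmk.trans hm
  calc _ ≤ P.real {ω | ENNReal.ofReal t ≤ Z ω} := measureReal_mono hsub (by finiteness)
    _ ≤ t⁻¹ := by
        rw [measureReal_def]
        exact ENNReal.toReal_le_of_le_ofReal (by positivity) h1
    _ ≤ (exp (l * c) / 2 * exp (-(v * (l ^ 2 * β) / 2)))⁻¹ := by
        refine inv_anti₀ (by positivity) ?_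
        rw [ht, cosh_eq]
        gcongr
        linarith [exp_pos (-(l * c))]
    _ = 2 * exp (-(c ^ 2 / (2 * v * β))) := by
        rw [mul_inv, inv_div, ← exp_neg, div_mul_eq_mul_div, mul_div_assoc, ← exp_sub]
        congr 2
        rw [hl]
        field_simp
        ring

end Supermartingale

/-! ### The deviation bound for the process started at rest -/

section Rest

open Real

variable {n : ℕ} {θ : EuclideanSpace ℝ (Fin n)}

lemma norm_sq_transition_mulVec_le (x : Fin (n + 1) → ℝ) :
    ‖WithLp.toLp 2 (Matrix.mulVec (transition θ) x)‖ ^ 2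
      ≤ (‖θ‖ + 1) ^ 2 * ∑ j : Fin n, x j.castSucc ^ 2 := by
  rw [EuclideanSpace.real_norm_sq_eq, Fin.sum_univ_succ]
  simp only [transition_mulVec_zero, transition_mulVec_succ]
  have h1 : (∑ k : Fin n, θ k * x k.castSucc) ^ 2 ≤ ‖θ‖ ^ 2 * ∑ j : Fin n, x j.castSucc ^ 2 := by
    rw [EuclideanSpace.real_norm_sq_eq]
    exact Finset.sum_mul_sq_le_sq_mul_sq _ _ _
  have h2 : 0 ≤ ∑ j : Fin n, x j.castSucc ^ 2 := Finset.sum_nonneg fun _ _ => sq_nonneg _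
  nlinarith [mul_nonneg (norm_nonneg θ) h2]

/-- The last column of `A` is zero, so only `n` lags enter; each lag shifts the sum to a subset of
the same window of `N` outputs. -/
lemma sum_norm_sq_transition_state_le (u : ℕ → ℝ) (T : ℕ) {N : ℕ} (hN : n < N) :
    ∑ k ∈ Finset.range (N - n),
        ‖WithLp.toLp 2 (Matrix.mulVec (transition θ) (state θ u (T + n + k)))‖ ^ 2
      ≤ (‖θ‖ + 1) ^ 2 * (n * ∑ t ∈ Finset.range N, state θ u (T + t) 0 ^ 2) := by
  refine (Finset.sum_le_sum fun k _ => norm_sq_transition_mulVec_le _).trans ?_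
  rw [← Finset.mul_sum, Finset.sum_comm]
  refine mul_le_mul_of_nonneg_left ?_ (sq_nonneg _)
  calc _ ≤ ∑ _j : Fin n, ∑ t ∈ Finset.range N, state θ u (T + t) 0 ^ 2 := by
        refine Finset.sum_le_sum fun j _ => ?_
        have hinj : Set.InjOn (fun k => n + k - (j : ℕ)) (Finset.range (N - n)) := by
          intro a _ b _ hab
          simp only at hab
          omega
        calc _ = ∑ t ∈ (Finset.range (N - n)).image fun k => n + k - (j : ℕ),
              state θ u (T + t) 0 ^ 2 := by
              rw [Finset.sum_image hinj]
              refine Finset.sum_congr rfl fun k _ => ?_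
              rw [state_apply, Fin.val_castSucc,
                show T + n + k - (j : ℕ) = T + (n + k - j) by omega]
          _ ≤ _ := by
              refine Finset.sum_le_sum_of_subset_of_nonneg (fun t ht => ?_) fun _ _ _ => sq_nonneg _
              obtain ⟨k, hk, rfl⟩ := Finset.mem_image.1 ht
              have := Finset.mem_range.1 hk
              exact Finset.mem_range.2 (by omega)
    _ = _ := by simp

lemma energy_threshold_le {σ m ε M : ℝ} {N : ℕ} (hσ : 0 < σ) (hε : 0 < ε) (hM : 0 < M)
    (hN : 0 < N) :
    N * m + 2 * (σ ^ 2 * M) * √(N * (ε * √N)) + 2 * (σ ^ 2 * M) * (ε * √N)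
      ≤ N * (ε * σ ^ 2) *
        (m / (ε * σ ^ 2) + 2 * M * (1 + ε ^ (-(1 / 2) : ℝ)) / (N : ℝ) ^ (1 / 4 : ℝ)) := by
  have hN' : (1 : ℝ) ≤ N := by exact_mod_cast hN
  have hN0 : (0 : ℝ) < N := by linarith
  set a : ℝ := (N : ℝ) ^ (1 / 4 : ℝ) with ha
  set b : ℝ := ε ^ (-(1 / 2) : ℝ) with hb
  have ha1 : 1 ≤ a := one_le_rpow hN' (by norm_num)
  have ha4 : a ^ 4 = N := by
    rw [ha, ← rpow_natCast, ← rpow_mul hN0.le]; norm_num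
  have hb0 : 0 < b := rpow_pos_of_pos hε _
  have hb2 : b ^ 2 * ε = 1 := by
    rw [hb, ← rpow_natCast, ← rpow_mul hε.le]
    norm_num
    rw [rpow_neg_one, inv_mul_cancel₀ hε.ne']
  have hs : √(N : ℝ) = a ^ 2 := by
    rw [← ha4, show a ^ 4 = (a ^ 2) ^ 2 by ring, sqrt_sq (by positivity)]
  have hs2 : √(N * (ε * √N)) = a ^ 3 * (ε * b) := by
    rw [hs, ← ha4, show a ^ 4 * (ε * a ^ 2) = (a ^ 3) ^ 2 * (b ^ 2 * ε * ε) by rw [hb2]; ring,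
      show (a ^ 3) ^ 2 * (b ^ 2 * ε * ε) = (a ^ 3 * (ε * b)) ^ 2 by ring, sqrt_sq (by positivity)]
  rw [hs2, hs, ← ha4]
  have e : a ^ 4 * (ε * σ ^ 2) * (m / (ε * σ ^ 2) + 2 * M * (1 + b) / a)
      = a ^ 4 * m + 2 * (σ ^ 2 * M) * (a ^ 3 * (ε * b)) + 2 * (σ ^ 2 * M) * (ε * a ^ 3) := by
    field_simp
    ring
  rw [e]
  -- Only the last term is loosened: `√N = a ^ 2 ≤ a ^ 3`.
  gcongr
  norm_num

lemma measurable_state {Ω : Type*} {w : ℕ → Ω → ℝ} {m : MeasurableSpace Ω} {s : ℕ} (hw : ∀ r < s, Measurable[m] (w r)) :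
    Measurable[m] fun ω => state θ (fun r => w r ω) s := by
  refine measurable_pi_lambda _ fun i => ?_
  simp only [state_apply θ _ s i, state_apply_zero]
  refine Finset.measurable_fun_sum _ fun r hr => (hw r ?_).const_mul _
  have := Finset.mem_range.1 hr
  omega

variable {Ω : Type*} [mΩ : MeasurableSpace Ω] {P : Measure Ω} [IsProbabilityMeasure P]
  {w : ℕ → Ω → ℝ} {σ : ℝ}

lemma measure_state_norm_ge_le (hw : ∀ s, Measurable (w s)) (hind : iIndepFun w P)
    (hlaw : ∀ s, HasLaw (w s) (gaussianReal 0 (toNNReal (σ ^ 2))) P) {m : ℝ} (hm0 : 0 < m)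
    (hm : ∀ s, σ ^ 2 * ∑ k ∈ Finset.range s, impulse θ k ^ 2 ≤ m) (s : ℕ) (c : ℝ) :
    P.real {ω | c ≤ ∑ i, state θ (fun r => w r ω) s i ^ 2}
      ≤ √2 * exp (-c / (4 * (n + 1) * m)) := by
  have := measure_sum_sq_ge_le (P := P) (k := n + 1) (Nat.succ_pos n)
    (Y := fun i ω => state θ (fun r => w r ω) s i)
    (v := fun i => toNNReal (σ ^ 2 * ∑ k ∈ Finset.range (s - i), impulse θ k ^ 2)) hm0
    (fun i => by
      rw [coe_toNNReal _ (by positivity)]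
      exact hm _)
    (fun i => by
      simp only [state_apply θ _ s i]
      exact hasLaw_state_zero hw hind hlaw (s - i)) c
  push_cast at this
  exact this

/-- The state at time `T + k` involves only noise of index below `T + k`, so it is adapted to the
filtration `ℱ` of past noise and independent of `w (T + k)`. -/
lemma measure_cross_ge_le (hσ : 0 < σ) (hw : ∀ s, Measurable (w s)) (hind : iIndepFun w P)
    (hlaw : ∀ s, HasLaw (w s) (gaussianReal 0 (toNNReal (σ ^ 2))) P) (T K : ℕ) {c β : ℝ}
    (hc : 0 < c) (hβ : 0 < β) :
    P.real {ω | c ≤ ‖∑ k ∈ Finset.range K, w (T + k) ω •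
        WithLp.toLp 2 (Matrix.mulVec (transition θ) (state θ (fun r => w r ω) (T + k)))‖ ∧
      ∑ k ∈ Finset.range K,
        ‖WithLp.toLp 2 (Matrix.mulVec (transition θ) (state θ (fun r => w r ω) (T + k)))‖ ^ 2 ≤ β}
      ≤ 2 * exp (-(c ^ 2 / (2 * σ ^ 2 * β))) := by
  set ℱ : ℕ → MeasurableSpace Ω :=
    fun k => ⨆ r ∈ Set.Iio (T + k), MeasurableSpace.comap (w r) inferInstance with hℱ
  have hle (r) : MeasurableSpace.comap (w r) inferInstance ≤ mΩ := (hw r).comap_le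
  have hwm (r k) (h : r < T + k) : Measurable[ℱ k] (w r) :=
    measurable_iff_comap_le.2 (le_iSup₂_of_le r (Set.mem_Iio.2 h) le_rfl)
  have := measure_norm_sum_ge_le (P := P) (ℱ := ℱ) (fun k => iSup₂_le fun r _ => hle r)
    (fun j k hjk => biSup_mono fun r hr => Set.mem_Iio.2 (by
      have := Set.mem_Iio.1 hr
      omega))
    (X := fun k ω =>
      WithLp.toLp 2 (Matrix.mulVec (transition θ) (state θ (fun r => w r ω) (T + k))))
    (ξ := fun k => w (T + k)) (v := toNNReal (σ ^ 2)) (by positivity)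
    (fun k => by
      have hst : Measurable[ℱ k] fun ω => state θ (fun r => w r ω) (T + k) :=
        measurable_state fun r hr => hwm r k hr
      have hL : Measurable fun x : Fin (n + 1) → ℝ =>
          (WithLp.toLp 2 (Matrix.mulVec (transition θ) x) : EuclideanSpace ℝ (Fin (n + 1))) := by
        refine (WithLp.measurable_toLp 2 _).comp (Continuous.measurable ?_)
        exact continuous_const.matrix_mulVec continuous_id
      exact hL.comp hst)
    (fun k => hwm _ _ (by omega)) (fun k => hlaw _)
    (fun k => by
      have hi := indep_iSup_of_disjoint hle hind (S := Set.Iio (T + k)) (T := {T + k}) (by simp)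
      simpa [hℱ] using hi) K hc hβ
  rwa [coe_toNNReal _ (sq_nonneg σ)] at this

/-- The deviation bound for the process started at rest, on an arbitrary window. -/
theorem measure_not_isWithinBounds_le (h : IsSchur (charPoly θ)) (hn : 1 ≤ n) {N : ℕ} (hN : n < N)
    (hσ : 0 < σ) (hw : ∀ s, Measurable (w s)) (hind : iIndepFun w P)
    (hlaw : ∀ s, HasLaw (w s) (gaussianReal 0 (toNNReal (σ ^ 2))) P) {m : ℝ}
    (hm : ∀ s, σ ^ 2 * ∑ k ∈ Finset.range s, impulse θ k ^ 2 ≤ m) {ε : ℝ} (hε : 0 < ε) (T : ℕ) :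
    P.real {ω | ¬ IsWithinBounds θ σ ε N
      (stateMatrix n N fun k => state θ (fun r => w r ω) (T + n + k))} ≤ delta θ σ m ε N := by
  have hm0 : 0 < m := by
    have := hm 1
    simp only [Finset.range_one, Finset.sum_singleton, impulse, pow_zero, Matrix.one_apply_eq,
      one_pow, mul_one] at this
    exact lt_of_lt_of_le (by positivity) this
  have hn' : (1 : ℝ) ≤ n := by exact_mod_cast hn
  have hKcast : ((N - n : ℕ) : ℝ) = (N : ℝ) - n := Nat.cast_sub hN.le
  have hK0 : (0 : ℝ) < (N : ℝ) - n := by rw [← hKcast]; exact_mod_cast Nat.sub_pos_of_lt hN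
  have hN0 : 0 < N := by omega
  have hN0' : (0 : ℝ) < N := by exact_mod_cast hN0
  have hM := MPhi_pos h
  set c : ℝ := ((N : ℝ) - n) * (ε * σ ^ 2) / 3 with hc
  have hc0 : 0 < c := by positivity
  set br : ℝ := m / (ε * σ ^ 2) + 2 * MPhi θ * (1 + ε ^ (-(1 / 2) : ℝ)) / (N : ℝ) ^ (1 / 4 : ℝ)
    with hbr
  have hbr0 : 0 < br := by
    have := rpow_pos_of_pos hε (-(1 / 2) : ℝ)
    have := rpow_pos_of_pos hN0' (1 / 4 : ℝ)
    positivity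
  have hbt : betaTilde θ σ m ε N = ((n : ℝ) + 1) * N / ((N : ℝ) - n) * br := rfl
  -- The bracket bound on the good energy event, enlarged from `n` to `n + 1` so that the resulting
  -- exponent is exactly the one with `betaTilde`.
  set β : ℝ := (‖θ‖ + 1) ^ 2 * (((n : ℝ) + 1) * (N * (ε * σ ^ 2) * br)) with hβ
  have hβ0 : 0 < β := by positivity
  set x : ℝ := ε * √N with hx
  have hth := energy_threshold_le (m := m) hσ hε hM hN0
  rw [← hbr, ← hx] at hth
  have b1 := measure_state_norm_ge_le hw hind hlaw hm0 hm (T + n) c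
  have b2 := measure_state_norm_ge_le hw hind hlaw hm0 hm (T + n + (N - n)) c
  have b3 := measure_noise_sq_ge_le hσ hind hlaw (T + n) (Nat.sub_pos_of_lt hN) hε
  -- The threshold is `c / 2` because the Loewner bound asks for `4‖v‖² ≤ c²`.
  have b4 := measure_cross_ge_le (θ := θ) hσ hw hind hlaw (T + n) (N - n) (half_pos hc0) hβ0
  have b5 := measure_energy_ge_le h hσ hind hlaw hm T hN0 (x := x) (by positivity)
  rw [hKcast] at b3
  refine le_trans (measureReal_mono (s₂ := _ ∪ _ ∪ _ ∪ _ ∪ _) (fun ω hω => ?_) (by finiteness))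
    (le_trans ((measureReal_union_le _ _).trans (add_le_add ((measureReal_union_le _ _).trans
      (add_le_add ((measureReal_union_le _ _).trans (add_le_add ((measureReal_union_le _ _).trans
        (add_le_add b1 b2)) b3)) b4)) b5)) ?_)
  · by_contra hcon
    simp only [Set.mem_union, Set.mem_ofPred_eq, not_or, not_le, not_lt, not_and] at hcon
    obtain ⟨⟨⟨⟨g1, g2⟩, g3⟩, g4⟩, g5⟩ := hcon
    refine hω (isWithinBounds_of_state_bounds h (c := c) (u := fun k => w (T + n + k) ω)
      (by rw [hc]; ring) (fun k => rfl) ?_ ?_ ?_ ?_)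
    · simp only [dotProduct, ← sq]
      exact g1.le
    · simp only [dotProduct, ← sq]
      exact g2.le
    · refine g3.trans (le_of_eq ?_)
      rw [hc]; ring
    · have hq := (sum_norm_sq_transition_state_le (θ := θ) (fun r => w r ω) T hN).trans
        (mul_le_mul_of_nonneg_left
          (mul_le_mul_of_nonneg_left (g5.le.trans hth) (by positivity)) (sq_nonneg _))
      have hqβ : (‖θ‖ + 1) ^ 2 * (n * (N * (ε * σ ^ 2) * br)) ≤ β := by
        rw [hβ]
        gcongr
        linarith
      have hlt : ‖∑ k ∈ Finset.range (N - n), w (T + n + k) ω • WithLp.toLp 2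
          (Matrix.mulVec (transition θ) (state θ (fun r => w r ω) (T + n + k)))‖ < c / 2 := by
        by_contra hge
        exact absurd (hq.trans hqβ) (not_le.2 (g4 (not_lt.1 hge)))
      have hsq := pow_le_pow_left₀ (norm_nonneg _) hlt.le 2
      rw [EuclideanSpace.real_norm_sq_eq] at hsq
      have e : ∀ i, (∑ k ∈ Finset.range (N - n), w (T + n + k) ω • WithLp.toLp 2
          (Matrix.mulVec (transition θ) (state θ (fun r => w r ω) (T + n + k)))).ofLp i
          = (∑ k ∈ Finset.range (N - n), w (T + n + k) ω •
          Matrix.mulVec (transition θ) (state θ (fun r => w r ω) (T + n + k))) i := by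
        intro i
        simp [WithLp.ofLp_sum]
      simp only [e] at hsq
      simp only [dotProduct, ← sq]
      linarith
  -- The states have `n + 1` coordinates, and `n + 1 ≤ 2n` turns `12 (n + 1)` into `24 n`.
  · have e1 : exp (-c / (4 * (n + 1) * m))
        ≤ exp (-(((N : ℝ) - n) * σ ^ 2 * ε) / (24 * n * m)) := by
      refine exp_le_exp.2 ?_
      rw [neg_div, neg_div, neg_le_neg_iff, hc, div_div,
        show ((N : ℝ) - n) * σ ^ 2 * ε = ((N : ℝ) - n) * (ε * σ ^ 2) by ring]
      refine div_le_div_of_nonneg_left (by positivity) (by positivity) ?_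
      nlinarith
    have e4 : (c / 2) ^ 2 / (2 * σ ^ 2 * β)
        = (((N : ℝ) - n) * ε) / (72 * (‖θ‖ + 1) ^ 2 * betaTilde θ σ m ε N) := by
      rw [hbt, hβ, hc]
      field_simp
      ring
    rw [delta, e4]
    have := mul_le_mul_of_nonneg_left e1 (sqrt_nonneg 2)
    -- The energy event is used once whereas `delta` counts it twice; the spare copy is dropped.
    have := exp_pos (-x)
    linarith

end Rest

/-! ### Passage to the stationary process -/

section Stationary

open Real Filter Topology Matrix

variable {n : ℕ} {θ : EuclideanSpace ℝ (Fin n)} {Ω : Type*}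

/-- The extended regressor `[y_t, …, y_{t-n}]`. -/
def lagVector (n : ℕ) (y : ℤ → Ω → ℝ) (t : ℤ) (ω : Ω) : Fin (n + 1) → ℝ :=
  fun i => y (t - (i : ℕ)) ω

/-- The noise sequence seen from time `-T`. -/
def noiseFrom (e : ℤ → Ω → ℝ) (T : ℕ) (s : ℕ) : Ω → ℝ := e ((s : ℤ) - T + 1)

/-- Both sequences obey the same recursion with the same noise, so their difference evolves freely
under `A`. -/
lemma lagVector_sub_state {y e : ℤ → Ω → ℝ} {ω : Ω}
    (h : ∀ t : ℤ, lagVector n y (t + 1) ω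
      = transition θ *ᵥ lagVector n y t ω + e (t + 1) ω • Pi.single 0 1) (T s : ℕ) :
    lagVector n y ((s : ℤ) - T) ω - state θ (fun r => noiseFrom e T r ω) s
      = transition θ ^ s *ᵥ lagVector n y (-T) ω := by
  induction s with
  | zero => simp
  | succ s ih =>
    have hs : ((s + 1 : ℕ) : ℤ) - T = (s : ℤ) - T + 1 := by push_cast; ring
    rw [hs, h, state_succ, pow_succ', ← mulVec_mulVec, ← ih, mulVec_sub]
    simp only [noiseFrom]
    abel

lemma dataMatrix_eq_stateMatrix (n N : ℕ) (y : ℤ → Ω → ℝ) (ω : Ω) :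
    dataMatrix n N y ω = stateMatrix n N fun k => lagVector n y ((n + k : ℕ) : ℤ) ω := by
  ext i j
  simp [dataMatrix, stateMatrix, lagVector, regressor]

variable [MeasurableSpace Ω] {P : Measure Ω}

lemma ae_lagVector_succ {y e : ℤ → Ω → ℝ} (hAR : SatisfiesAR P θ y e) :
    ∀ᵐ ω ∂P, ∀ t : ℤ, lagVector n y (t + 1) ω
      = transition θ *ᵥ lagVector n y t ω + e (t + 1) ω • Pi.single 0 1 := by
  rw [ae_all_iff]
  intro t
  filter_upwards [hAR (t + 1)] with ω hω
  ext i
  refine Fin.cases ?_ (fun i => ?_) i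
  · rw [Pi.add_apply, transition_mulVec_zero]
    simp only [lagVector, Fin.val_zero, Nat.cast_zero, sub_zero, Fin.val_castSucc, Pi.smul_apply,
      Pi.single_eq_same, smul_eq_mul, mul_one]
    rw [hω]
    congr 1
    refine Finset.sum_congr rfl fun k _ => ?_
    rw [regressor, mul_comm, add_sub_cancel_right]
  · rw [Pi.add_apply, transition_mulVec_succ]
    simp [lagVector]

lemma measurable_mulVec_lag (A : Matrix (Fin (n + 1)) (Fin (n + 1)) ℝ) :
    Measurable fun f : ℤ → ℝ => A *ᵥ fun i : Fin (n + 1) => f (-((i : ℕ) : ℤ)) := by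
  have h1 : Measurable fun f : ℤ → ℝ => fun i : Fin (n + 1) => f (-((i : ℕ) : ℤ)) :=
    measurable_pi_lambda _ fun i => measurable_pi_apply _
  have h2 : Continuous fun x : Fin (n + 1) → ℝ => A *ᵥ x :=
    continuous_const.matrix_mulVec continuous_id
  exact h2.measurable.comp h1

lemma integral_sq_gaussianReal (V : NNReal) : ∫ x, x ^ 2 ∂(gaussianReal 0 V) = V := by
  rw [← variance_of_integral_eq_zero (X := fun x => x) (by fun_prop) (by simp)]
  exact variance_fun_id_gaussianReal

lemma integral_sq_of_hasLaw {Y : Ω → ℝ} {V : NNReal} (hY : HasLaw Y (gaussianReal 0 V) P) :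
    ∫ ω, Y ω ^ 2 ∂P = V := by
  rw [← integral_sq_gaussianReal V, ← hY.map_eq, integral_map hY.aemeasurable
    (Continuous.aestronglyMeasurable (by fun_prop))]

lemma iIndepFun_noiseFrom {e : ℤ → Ω → ℝ} (h : iIndepFun e P) (T : ℕ) :
    iIndepFun (noiseFrom e T) P :=
  h.precomp (g := fun s : ℕ => (s : ℤ) - T + 1) fun a b hab => by
    simp only at hab
    omega

variable [IsProbabilityMeasure P]

/-- By stationarity `A ^ T` applied to the state at `-T` has the same law as `A ^ T` applied to the
state at `0`, which tends to `0` pointwise. Equality of laws transfers only convergence in measure,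
hence the later passage to a subsequence. -/
lemma tendstoInMeasure_transition_pow_lag (hS : IsSchur (charPoly θ)) {y : ℤ → Ω → ℝ}
    (hy : IsStationary P y) :
    TendstoInMeasure P (fun (T : ℕ) ω => transition θ ^ T *ᵥ lagVector n y (-T) ω) atTop
      fun _ => 0 := by
  have hlaw (T : ℕ) : IdentDistrib (fun ω => transition θ ^ T *ᵥ lagVector n y (-T) ω)
      (fun ω => transition θ ^ T *ᵥ lagVector n y 0 ω) P P := by
    have := (hy (-T)).comp (measurable_mulVec_lag (n := n) (transition θ ^ T))
    convert this using 1
    · ext ω : 1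
      simp only [Function.comp_def]
      congr 1
      ext i
      simp [lagVector, add_comm, sub_eq_add_neg]
    · ext ω : 1
      simp only [Function.comp_def]
      congr 1
      ext i
      simp [lagVector]
  have h0 : TendstoInMeasure P (fun (T : ℕ) ω => transition θ ^ T *ᵥ lagVector n y 0 ω) atTop
      fun _ => 0 := by
    refine tendstoInMeasure_of_tendsto_ae
      (fun T => (hlaw T).aemeasurable_snd.aestronglyMeasurable) (ae_of_all _ fun ω => ?_)
    have hc : Continuous fun M : Matrix (Fin (n + 1)) (Fin (n + 1)) ℝ =>
      M *ᵥ lagVector n y 0 ω := continuous_id.matrix_mulVec continuous_const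
    simpa [Function.comp_def] using (hc.tendsto 0).comp (tendsto_transition_pow hS)
  intro δ hδ
  refine (h0 δ hδ).congr fun T => ?_
  exact ((hlaw T).measure_mem_eq (s := {x | δ ≤ edist x 0})
    (isClosed_le continuous_const (by fun_prop)).measurableSet).symm

/-- Along a subsequence, the processes started at rest converge to the stationary one. -/
lemma exists_seq_tendsto_state (hS : IsSchur (charPoly θ)) {y e : ℤ → Ω → ℝ}
    (hAR : SatisfiesAR P θ y e) (hy : IsStationary P y) :
    ∃ ns : ℕ → ℕ, StrictMono ns ∧ ∀ᵐ ω ∂P, ∀ j : ℕ, Tendsto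
      (fun i => state θ (fun r => noiseFrom e (ns i) r ω) (ns i + j)) atTop
      (𝓝 (lagVector n y j ω)) := by
  obtain ⟨ns, hns, hlim⟩ := (tendstoInMeasure_transition_pow_lag hS hy).exists_seq_tendsto_ae
  refine ⟨ns, hns, ?_⟩
  filter_upwards [hlim, ae_lagVector_succ hAR] with ω h1 h2 j
  have hst (i : ℕ) : state θ (fun r => noiseFrom e (ns i) r ω) (ns i + j) = lagVector n y j ω
      - transition θ ^ j *ᵥ (transition θ ^ ns i *ᵥ lagVector n y (-(ns i : ℕ)) ω) := by
    have := lagVector_sub_state h2 (ns i) (ns i + j)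
    rw [show ((ns i + j : ℕ) : ℤ) - (ns i : ℕ) = j by push_cast; ring, add_comm (ns i) j,
      pow_add, ← mulVec_mulVec] at this
    rw [add_comm (ns i) j, ← this]
    abel
  simp only [hst]
  have hc : Continuous fun x : Fin (n + 1) → ℝ => transition θ ^ j *ᵥ x :=
    continuous_const.matrix_mulVec continuous_id
  simpa using tendsto_const_nhds.sub ((hc.tendsto 0).comp h1)

/-- An almost sure limit of centred Gaussian variables with convergent variances is Gaussian. -/
lemma hasLaw_of_tendsto_gaussian {Z : ℕ → Ω → ℝ} {Y : Ω → ℝ} {v : ℕ → NNReal} {V : NNReal}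
    (hZ : ∀ i, HasLaw (Z i) (gaussianReal 0 (v i)) P) (hv : Tendsto v atTop (𝓝 V))
    (hlim : ∀ᵐ ω ∂P, Tendsto (fun i => Z i ω) atTop (𝓝 (Y ω))) :
    HasLaw Y (gaussianReal 0 V) P := by
  have hY : AEMeasurable Y P := aemeasurable_of_tendsto_metrizable_ae' (fun i => (hZ i).aemeasurable)
    hlim
  have : IsProbabilityMeasure (P.map Y) := Measure.isProbabilityMeasure_map hY
  refine ⟨hY, Measure.ext_of_charFun ?_⟩
  ext u
  -- The characteristic functions converge by dominated convergence on one side and by continuity in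
  -- the variance on the other.
  have hchar {W : Ω → ℝ} (hW : AEMeasurable W P) :
      charFun (P.map W) u = ∫ ω, Complex.exp (u * W ω * Complex.I) ∂P := by
    rw [charFun_apply_real, integral_map hW (Continuous.aestronglyMeasurable (by fun_prop))]
  have h1 : Tendsto (fun i => charFun (P.map (Z i)) u) atTop (𝓝 (charFun (P.map Y) u)) := by
    simp only [hchar hY, hchar (hZ _).aemeasurable]
    refine tendsto_integral_of_dominated_convergence (fun _ => 1) (fun i => ?_)
      (integrable_const _) (fun i => ae_of_all _ fun ω => ?_) ?_
    · have : Measurable fun x : ℝ => Complex.exp (u * x * Complex.I) :=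
        Continuous.measurable (by fun_prop)
      exact (this.comp_aemeasurable (hZ i).aemeasurable).aestronglyMeasurable
    · rw [← Complex.ofReal_mul, Complex.norm_exp_ofReal_mul_I]
    · filter_upwards [hlim] with ω hω
      have : Continuous fun x : ℝ => Complex.exp (u * x * Complex.I) := by fun_prop
      exact (this.tendsto _).comp hω
  have h2 : Tendsto (fun i => charFun (P.map (Z i)) u) atTop (𝓝 (charFun (gaussianReal 0 V) u)) := by
    simp only [(hZ _).map_eq, charFun_gaussianReal]
    have hc : Continuous fun a : NNReal =>
        Complex.exp (u * (0 : ℝ) * Complex.I - (a : ℝ) * u ^ 2 / 2) := by fun_prop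
    exact (hc.tendsto V).comp hv
  exact tendsto_nhds_unique h1 h2

/-- The deviation bound for the stationary process driven by measurable white noise. -/
lemma measure_not_isWithinBounds_stationary_le (hn : 1 ≤ n) {N : ℕ} (hN : n < N) {σ : ℝ}
    (hσ : 0 < σ) {y e : ℤ → Ω → ℝ} (hSchur : IsSchur (charPoly θ)) (hem : ∀ t, Measurable (e t))
    (he : IsGaussianWhiteNoise P σ e) (hAR : SatisfiesAR P θ y e) (hy : IsStationary P y)
    {ε : ℝ} (hε : 0 < ε) :
    P.real {ω | ¬ IsWithinBounds θ σ ε N (dataMatrix n N y ω)}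
      ≤ delta θ σ (∫ ω, y 1 ω ^ 2 ∂P) ε N := by
  obtain ⟨ns, hns, hlim⟩ := exists_seq_tendsto_state hSchur hAR hy
  have hwm (T s : ℕ) : Measurable (noiseFrom e T s) := hem _
  have hwi (T : ℕ) := iIndepFun_noiseFrom he.1 T
  have hwl (T s : ℕ) : HasLaw (noiseFrom e T s) (gaussianReal 0 (toNNReal (σ ^ 2))) P := he.2 _
  have hsum : Summable fun k => impulse θ k ^ 2 :=
    summable_of_sum_range_le (fun _ => sq_nonneg _) (sum_sq_impulse_le hSchur)
  set V : ℝ := σ ^ 2 * ∑' k, impulse θ k ^ 2 with hV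
  -- Identifies `E{y_1²}` with `V`, which dominates the output variances of all processes started at
  -- rest.
  have hlaw : HasLaw (y 1) (gaussianReal 0 (toNNReal V)) P := by
    refine hasLaw_of_tendsto_gaussian
      (fun i => hasLaw_state_zero (θ := θ) (hwm (ns i)) (hwi (ns i)) (hwl (ns i)) (ns i + 1)) ?_ ?_
    · refine (continuous_real_toNNReal.tendsto V).comp (Tendsto.const_mul _ ?_)
      exact hsum.hasSum.tendsto_sum_nat.comp
        ((tendsto_add_atTop_iff_nat 1).2 tendsto_id |>.comp hns.tendsto_atTop)
    · filter_upwards [hlim] with ω hω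
      simpa [lagVector] using (tendsto_pi_nhds.1 (hω 1)) 0
  have hm : ∫ ω, y 1 ω ^ 2 ∂P = V := by
    rw [integral_sq_of_hasLaw hlaw, coe_toNNReal]
    exact mul_nonneg (sq_nonneg _) (tsum_nonneg fun _ => sq_nonneg _)
  rw [hm]
  have hVs (s : ℕ) : σ ^ 2 * ∑ k ∈ Finset.range s, impulse θ k ^ 2 ≤ V :=
    mul_le_mul_of_nonneg_left (hsum.sum_le_tsum _ fun _ _ => sq_nonneg _) (sq_nonneg _)
  set B : ℕ → Set Ω := fun i => {ω | ¬ IsWithinBounds θ σ ε N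
    (stateMatrix n N fun k => state θ (fun r => noiseFrom e (ns i) r ω) (ns i + n + k))} with hB
  have hBi (i) : P.real (B i) ≤ delta θ σ V ε N :=
    measure_not_isWithinBounds_le hSchur hn hN hσ (hwm _) (hwi _) (hwl _) hVs hε (ns i)
  -- The bad set of matrices is open, so a bad limit forces the approximations to be bad from some
  -- index on. The right-hand side is the lower limit of the sets `B i`, an increasing union of sets
  -- of probability at most `delta`.
  have hsub : {ω | ¬ IsWithinBounds θ σ ε N (dataMatrix n N y ω)}
      ≤ᵐ[P] ⋃ k, ⋂ i ∈ Set.Ici k, B i := by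
    filter_upwards [hlim] with ω hω hbad
    have hD : Tendsto (fun i => stateMatrix n N fun k =>
        state θ (fun r => noiseFrom e (ns i) r ω) (ns i + n + k)) atTop
        (𝓝 (dataMatrix n N y ω)) := by
      rw [dataMatrix_eq_stateMatrix]
      refine tendsto_pi_nhds.2 fun a => tendsto_pi_nhds.2 fun b => ?_
      simpa [stateMatrix, add_assoc] using (tendsto_pi_nhds.1 (hω (n + a))) b.castSucc
    have hev := hD.eventually ((isClosed_isWithinBounds θ σ ε N).isOpen_compl.mem_nhds hbad)
    obtain ⟨k, hk⟩ := eventually_atTop.1 hev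
    exact Set.mem_iUnion.2 ⟨k, Set.mem_iInter₂.2 fun i hi => hk i hi⟩
  have hmono : Monotone fun k => ⋂ i ∈ Set.Ici k, B i := fun k l hkl =>
    Set.biInter_subset_biInter_left fun i hi => le_trans hkl hi
  have hle : P (⋃ k, ⋂ i ∈ Set.Ici k, B i) ≤ ENNReal.ofReal (delta θ σ V ε N) := by
    rw [hmono.measure_iUnion]
    refine iSup_le fun k => (measure_mono (Set.biInter_subset_of_mem (Set.mem_Ici.2 le_rfl))).trans ?_
    rw [← ofReal_measureReal (by finiteness)]
    exact ENNReal.ofReal_le_ofReal (hBi k)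
  exact ENNReal.toReal_le_of_le_ofReal (measureReal_nonneg.trans (hBi 0))
    ((measure_mono_ae hsub).trans hle)

end Stationary

end ARProcess

end

theorem theorem1 {Ω : Type*} [MeasurableSpace Ω] (P : Measure Ω) [IsProbabilityMeasure P]
    (n N : ℕ) (hn : 1 ≤ n) (hN : n < N)
    (θ : EuclideanSpace ℝ (Fin n)) (σ : ℝ) (hσ : 0 < σ)
    (y e : ℤ → Ω → ℝ)
    (hSchur : ARProcess.IsSchur (ARProcess.charPoly θ))
    (he : ARProcess.IsGaussianWhiteNoise P σ e)
    (hAR : ARProcess.SatisfiesAR P θ y e)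
    (hy : ARProcess.IsStationary P y)
    (ε : ℝ) (hε : 0 < ε) (hV : (ARProcess.Vdn θ σ ε N).PosDef) :
    1 - ARProcess.delta θ σ (∫ ω, y 1 ω ^ 2 ∂P) ε N ≤
      P.real {ω |
        ((ARProcess.dataMatrix n N y ω).transpose * ARProcess.dataMatrix n N y ω
          - ARProcess.Vdn θ σ ε N).PosSemidef ∧
        (ARProcess.Vup θ σ ε N
          - (ARProcess.dataMatrix n N y ω).transpose * ARProcess.dataMatrix n N y ω).PosSemidef} := by
  -- The filtration argument needs measurable noise, while a law only gives almost everywhere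
  -- measurability; a measurable modification changes neither the law, the independence nor the
  -- recursion.
  set e' : ℤ → Ω → ℝ := fun t => (he.2 t).aemeasurable.mk (e t) with he'
  have hee' (t : ℤ) : e t =ᵐ[P] e' t := (he.2 t).aemeasurable.ae_eq_mk
  have hwn : ARProcess.IsGaussianWhiteNoise P σ e' :=
    ⟨he.1.congr hee', fun t => (he.2 t).congr (hee' t).symm⟩
  have hAR' : ARProcess.SatisfiesAR P θ y e' := fun t => by
    filter_upwards [hAR t, hee' t] with ω h1 h2
    rw [h1, h2]
  have hbad := ARProcess.measure_not_isWithinBounds_stationary_le hn hN hσ hSchur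
    (fun t => (he.2 t).aemeasurable.measurable_mk) hwn hAR' hy hε
  -- Subadditivity yields the lower bound without measurability of the event.
  have hcover := measureReal_union_le (μ := P)
    {ω | ARProcess.IsWithinBounds θ σ ε N (ARProcess.dataMatrix n N y ω)}
    {ω | ¬ ARProcess.IsWithinBounds θ σ ε N (ARProcess.dataMatrix n N y ω)}
  have huniv : {ω | ARProcess.IsWithinBounds θ σ ε N (ARProcess.dataMatrix n N y ω)}
      ∪ {ω | ¬ ARProcess.IsWithinBounds θ σ ε N (ARProcess.dataMatrix n N y ω)} = Set.univ :=
    Set.union_compl_self _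
  rw [huniv, probReal_univ] at hcover
  have := hcover.trans (add_le_add_right hbad _)
  exact sub_le_iff_le_add.2 this
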